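/- Let $n\ge 0$ and let $\sigma_r^{(v)}$ ($v=x,y,z$) be the Pauli operators of qubit $r$ on $(\mathbb C^2)^{\otimes n}$. Let $R_{rs}=\frac12\sum_{v}\sigma_r^{(v)}\sigma_s^{(v)}$, let $J_v=\frac12\sum_{i=1}^n\sigma_i^{(v)}$ and $J^2=J_x^2+J_y^2+J_z^2$. For $j\in\{j_{\min},j_{\min}+1,\dots,n/2\}$, where $j_{\min}=0$ for even $n$ and $j_{\min}=1/2$ for odd $n$, let $\Pi_j$ be the orthogonal projector onto the eigenspace of $J^2$ with eigenvalue $j(j+1)$. Let $C_0=\mathbb I$ and, for even $l\geq 2$, $$C_l=\frac1{(l/2)!}\sum_{i_1,\dots,i_l\ \text{distinct}}R_{i_1,i_2}\cdots R_{i_{l-1},i_l}$$ (so $C_l=0$ for even $l>n$). Let $c_l(j)=\operatorname{Tr}(C_l\Pi_j)/\operatorname{Tr}(\Pi_j)$. Let $m(a,j)=\binom{a}{a/2-j}\frac{2j+1}{a/2+j+1}$ for $j\le a/2$ and $m(a,j)=0$ for $j>a/2$. Below, $l,l'$ are even integers with $0\le l,l'\le n$, and $j$ ranges over the set above. Then: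 1. $C_l$ is Hermitian, $C_l=\sum_j c_l(j)\Pi_j$ and $C_l\Pi_j=c_l(j)\Pi_j$, where $\Pi_j\neq0$ and $\operatorname{Tr}(\Pi_j)=(2j+1)\,m(n,j)$. The eigenvalues $c_l(j)$ are integers, and $$c_l(j)=\frac{l!}{2^{l/2}(l/2)!}\binom nl\sum_{r=0}^{l/2}(-4)^r\binom{l/2}{r}\frac{m(n-2r,j)}{m(n,j)}.$$ 2. $\operatorname{Tr}(C_lC_{l'})=\sum_j\operatorname{Tr}(\Pi_j)\,c_l(j)\,c_{l'}(j)=\delta_{l,l'}\operatorname{Tr}(C_l^2)$, and the operators $C_0,C_2,\dots,C_{2\lfloor n/2\rfloor}$ are linearly independent and span $\operatorname{span}_{\mathbb C}\{\Pi_j\}$; that is, they form an orthogonal basis of it. 3. If $A$ is $k$-local with $k<l$ (that is, $A$ is an operator on some set of at most $k$ qubits tensored with the identity on the other qubits), then $\operatorname{Tr}(A^\dagger C_l)=0$. 4. There is a real polynomial $P_l$ of degree exactly $l/2$ with $c_l(j)=P_l(j(j+1))$ for all $j$; equivalently, $C_l=P_l(J^2)$. 5. For $l\geq2$, $$C_2C_l=\Big(\frac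 l2+1\Big)C_{l+2}+(n-l-1)\,l\,C_l+(l+1)\binom{n-l+2}{2}C_{l-2}.$$ -/

import Mathlib

namespace Qubits

noncomputable section

open Matrix

/-- Operators on the space `(ℂ²)^{⊗ n}` of `n` qubits, as matrices in the computational basis,
whose vectors are labelled by the strings `Fin n → Fin 2`. -/
abbrev Op (n : ℕ) : Type := Matrix (Fin n → Fin 2) (Fin n → Fin 2) ℂ

/-- The Pauli matrices `σ^(x), σ^(y), σ^(z)`. -/
def pauli : Fin 3 → Matrix (Fin 2) (Fin 2) ℂ :=
  ![!![0, 1; 1, 0], !![0, -Complex.I; Complex.I, 0], !![1, 0; 0, -1]]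

/-- The one-qubit operator `A` acting on qubit `r`, tensored with the identity on all other
qubits. -/
def onQubit {n : ℕ} (A : Matrix (Fin 2) (Fin 2) ℂ) (r : Fin n) : Op n :=
  Matrix.of fun x y => if ∀ s, s ≠ r → x s = y s then A (x r) (y r) else 0

/-- The exchange interaction `R_{rs} = ½ ∑_v σ_r^(v) σ_s^(v)`. -/
def exchange {n : ℕ} (r s : Fin n) : Op n :=
  (1 / 2 : ℂ) • ∑ v : Fin 3, onQubit (pauli v) r * onQubit (pauli v) s

/-- The component `J_v = ½ ∑_i σ_i^(v)` of the total angular momentum. -/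
def angMom (n : ℕ) (v : Fin 3) : Op n :=
  (1 / 2 : ℂ) • ∑ i : Fin n, onQubit (pauli v) i

/-- The total squared angular momentum `J² = J_x² + J_y² + J_z²`. -/
def angMomSq (n : ℕ) : Op n := ∑ v : Fin 3, angMom n v ^ 2

/-- The possible values of `t = 2j`, for `j = j_min, j_min + 1, …, n / 2`: the integers
`0 ≤ t ≤ n` of the parity of `n`. Throughout, the angular momentum `j` is represented by `t`. -/
def twiceSpins (n : ℕ) : Finset ℕ := (Finset.range (n + 1)).filter fun t => t % 2 = n % 2

/-- The sector `H_j`, `j = t / 2`: the eigenspace of `J²` for the eigenvalue `j (j + 1)`. -/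
def sector (n t : ℕ) : Submodule ℂ (EuclideanSpace ℂ (Fin n → Fin 2)) :=
  Module.End.eigenspace (Matrix.toEuclideanLin (angMomSq n)) ((t : ℂ) / 2 * ((t : ℂ) / 2 + 1))

/-- The orthogonal projector `Π_j`, `j = t / 2`, onto the sector `H_j`. -/
def proj (n t : ℕ) : Op n :=
  (Matrix.toEuclideanCLM (n := Fin n → Fin 2) (𝕜 := ℂ)).symm (sector n t).starProjection

/-- The operator `C_l` for even `l`:
`C_l = (1 / (l/2)!) ∑ R_{i₁ i₂} ⋯ R_{i_{l-1} i_l}` over all `l`-tuples of distinct qubits.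
A tuple is an injection of `Fin (l / 2) × Fin 2`, the `k`-th pair being `i (k, 0), i (k, 1)`.
For `l = 0` this is the identity, and for even `l > n` it is zero (an empty sum). -/
def cOp (n l : ℕ) : Op n :=
  (1 / ((l / 2).factorial : ℂ)) •
    ∑ i : (Fin (l / 2) × Fin 2) ↪ Fin n,
      (List.ofFn fun k : Fin (l / 2) => exchange (i (k, 0)) (i (k, 1))).prod

/-- The eigenvalue `c_l(j) = Tr(C_l Π_j) / Tr(Π_j)`, `j = t / 2`. -/
def cEig (n l t : ℕ) : ℂ := (cOp n l * proj n t).trace / (proj n t).trace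

/-- `m(a, j) = binom(a, a/2 - j) (2j + 1) / (a/2 + j + 1)` for `j = t / 2` with `t` of the parity
of `a`, and `m(a, j) = 0` for `j > a / 2`. -/
def mult (a t : ℕ) : ℝ :=
  if t ≤ a then
    (a.choose ((a - t) / 2) : ℝ) * (((t : ℝ) + 1) / ((a : ℝ) / 2 + (t : ℝ) / 2 + 1))
  else 0

/-- `A` is `k`-local: it acts non-trivially on at most `k` qubits, that is, it is an operator `B`
on some set `S` of at most `k` qubits tensored with the identity on the other qubits. -/
def IsLocal {n : ℕ} (k : ℕ) (A : Op n) : Prop :=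
  ∃ S : Finset (Fin n), S.card ≤ k ∧ ∃ B : Matrix (S → Fin 2) (S → Fin 2) ℂ,
    ∀ x y : Fin n → Fin 2,
      A x y = if ∀ r, r ∉ S → x r = y r then B (fun r => x r) (fun r => y r) else 0

end

end Qubits

namespace Qubits

open Matrix Finset

/-! Expanding the exchange interactions in Pauli strings makes `C_l` a permutation-symmetric sum. A
string with `a`, `b`, `c` letters x, y, z, `a + b + c = l`, gets as coefficient the number of ways
to pair off equal letters. This is the product of the Gaussian moments of orders `a`, `b`, `c`
(`cOp_eq_symC`). Hermiticity, trace orthogonality for different `l`, and orthogonality to `k`-local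
operators are then inherited from single Pauli strings.

The moment identity `k * g (k - 1) = g (k + 1)` lets one multiply by a component of the total spin
twice. The outcome is the three-term recursion `symC_two_mul_symC`. Since `C_2` is affine in `J²`,
the recursion makes `C_{2p}` a polynomial `polyC n p` in `J²`, of degree exactly `p`. Solving it
(`eval_polyC`) in the products `∏ (n/2 - j - i) (n/2 + j + 1 - i)`, which are multiples of `m(n -
2r, j) / m(n, j)`, gives the formula for `c_l(j)`.

The spectrum of `J²` is found without representation theory. The polynomial `polyC n (n / 2 + 1)`
vanishes at all `n / 2 + 1` candidates `j (j + 1)`, and it annihilates `J²` because `C_l = 0` for `l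
> n`. So a polynomial vanishing at the candidates annihilates `J²` (`aeval_eq_zero`), and the
Lagrange basis polynomials give the projectors `Π_j`. For the dimensions, `Tr C_{2p}` and `∑ (2j +
1) m(n, j) c_{2p}(j)` are both `2 ^ n` for `p = 0` and zero otherwise. The polynomials `polyC n p`
span `ℝ[X]`, so `Tr f(J²)` is the weighted sum of the values of `f` for every `f` (`trace_aeval`).
Taking `f` in the Lagrange basis yields `Tr Π_j`, which is positive, so every candidate does occur.
-/

/-! ### Tensor products and Pauli strings -/

/-- The tensor product of one-qubit operators. -/
def tens {n : ℕ} (M : Fin n → Matrix (Fin 2) (Fin 2) ℂ) : Op n :=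
  Matrix.of fun x y => ∏ i, M i (x i) (y i)

theorem tens_mul {n : ℕ} (M M' : Fin n → Matrix (Fin 2) (Fin 2) ℂ) :
    tens M * tens M' = tens fun i => M i * M' i := by
  ext x y
  simp only [tens, Matrix.mul_apply, Matrix.of_apply]
  rw [Finset.prod_univ_sum, Fintype.piFinset_univ]
  simp only [Finset.prod_mul_distrib]

theorem trace_tens {n : ℕ} (M : Fin n → Matrix (Fin 2) (Fin 2) ℂ) :
    (tens M).trace = ∏ i, (M i).trace := by
  simp only [tens, Matrix.trace, Matrix.diag, Matrix.of_apply]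
  rw [Finset.prod_univ_sum, Fintype.piFinset_univ]

theorem tens_one (n : ℕ) : tens (fun _ : Fin n => 1) = 1 := by
  ext x y
  simp only [tens, Matrix.of_apply, Matrix.one_apply, Finset.prod_ite_zero, Finset.prod_const_one]
  simp [funext_iff]

theorem conjTranspose_tens {n : ℕ} (M : Fin n → Matrix (Fin 2) (Fin 2) ℂ) :
    (tens M)ᴴ = tens fun i => (M i)ᴴ := by
  ext x y
  simp [tens, Matrix.conjTranspose_apply]

theorem tens_update_smul {n : ℕ} (M : Fin n → Matrix (Fin 2) (Fin 2) ℂ) (r : Fin n) (c : ℂ)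
    (A : Matrix (Fin 2) (Fin 2) ℂ) :
    tens (Function.update M r (c • A)) = c • tens (Function.update M r A) := by
  ext x y
  simp only [tens, Matrix.of_apply, Matrix.smul_apply, smul_eq_mul]
  rw [← Finset.mul_prod_erase _ _ (Finset.mem_univ r),
    ← Finset.mul_prod_erase _ (fun i => Function.update M r A i (x i) (y i)) (Finset.mem_univ r)]
  simp only [Function.update_self, Matrix.smul_apply, smul_eq_mul, mul_assoc]
  congr 2
  refine Finset.prod_congr rfl fun i hi => ?_
  rw [Function.update_of_ne (Finset.ne_of_mem_erase hi),
    Function.update_of_ne (Finset.ne_of_mem_erase hi)]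

theorem onQubit_eq_tens {n : ℕ} (A : Matrix (Fin 2) (Fin 2) ℂ) (r : Fin n) :
    onQubit A r = tens (Function.update (fun _ => 1) r A) := by
  ext x y
  simp only [onQubit, tens, Matrix.of_apply]
  rw [← Finset.mul_prod_erase _ _ (Finset.mem_univ r), Function.update_self]
  have : ∏ i ∈ univ.erase r, Function.update (fun _ : Fin n => (1 : Matrix (Fin 2) (Fin 2) ℂ)) r A i
      (x i) (y i) = ∏ i ∈ univ.erase r, if x i = y i then (1 : ℂ) else 0 := by
    refine Finset.prod_congr rfl fun i hi => ?_
    rw [Function.update_of_ne (Finset.ne_of_mem_erase hi), Matrix.one_apply]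
  rw [this, Finset.prod_ite_zero]
  simp

theorem onQubit_mul_tens {n : ℕ} (A : Matrix (Fin 2) (Fin 2) ℂ) (r : Fin n)
    (M : Fin n → Matrix (Fin 2) (Fin 2) ℂ) :
    onQubit A r * tens M = tens (Function.update M r (A * M r)) := by
  rw [onQubit_eq_tens, tens_mul]
  congr 1
  funext i
  by_cases h : i = r
  · subst h; simp
  · simp [h]

/-- The matrices `1, σ^(x), σ^(y), σ^(z)`. -/
def letter : Fin 4 → Matrix (Fin 2) (Fin 2) ℂ := 
  ![1, pauli 0, pauli 1, pauli 2]

/-- The letter of the product of two letters, up to phase. -/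
def letterMul : Fin 3 → Fin 4 → Fin 4 :=
  ![![1, 0, 3, 2], ![2, 3, 0, 1], ![3, 2, 1, 0]]

/-- The phase of the product of a Pauli matrix and a letter. -/
def letterPhase : Fin 3 → Fin 4 → ℂ :=
  ![![1, 1, Complex.I, -Complex.I], ![1, -Complex.I, 1, Complex.I],
    ![1, Complex.I, -Complex.I, 1]]

theorem pauli_mul_letter (v : Fin 3) (a : Fin 4) :
    pauli v * letter a = letterPhase v a • letter (letterMul v a) := by
  fin_cases v <;> fin_cases a <;> ext i j <;> fin_cases i <;> fin_cases j <;>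
    simp [letter, pauli, letterMul, letterPhase, Matrix.mul_apply]

theorem letterMul_letterMul (v : Fin 3) (a : Fin 4) : letterMul v (letterMul v a) = a := by
  revert v a; decide

theorem letter_isHermitian (a : Fin 4) : (letter a)ᴴ = letter a := by
  fin_cases a <;> ext i j <;> fin_cases i <;> fin_cases j <;>
    simp [letter, pauli, Matrix.conjTranspose_apply]

theorem trace_letter_mul (a b : Fin 4) (h : a ≠ b) : (letter a * letter b).trace = 0 := by
  fin_cases a <;> fin_cases b <;> first | exact absurd rfl h | 
    simp [letter, pauli, Matrix.trace]

/-- The Pauli string labelled by a word. -/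
def pauliString {n : ℕ} (w : Fin n → Fin 4) : Op n := tens fun i => letter (w i)

theorem pauliString_zero (n : ℕ) : pauliString (fun _ : Fin n => 0) = 1 := by
  rw [← tens_one]; rfl

theorem pauliString_isHermitian {n : ℕ} (w : Fin n → Fin 4) :
    (pauliString w)ᴴ = pauliString w := by
  simp only [pauliString, conjTranspose_tens, letter_isHermitian]

theorem trace_pauliString_mul {n : ℕ} {w w' : Fin n → Fin 4} (h : w ≠ w') :
    (pauliString w * pauliString w').trace = 0 := by
  obtain ⟨i, hi⟩ := Function.ne_iff.mp h
  rw [pauliString, pauliString, tens_mul, trace_tens]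
  exact Finset.prod_eq_zero (Finset.mem_univ i) (trace_letter_mul _ _ hi)

theorem onQubit_mul_pauliString {n : ℕ} (v : Fin 3) (r : Fin n) (w : Fin n → Fin 4) :
    onQubit (pauli v) r * pauliString w =
      letterPhase v (w r) • pauliString (Function.update w r (letterMul v (w r))) := by
  rw [pauliString, onQubit_mul_tens, pauli_mul_letter, tens_update_smul, pauliString]
  congr 2
  funext i
  by_cases h : i = r
  · subst h; simp
  · simp [h]

/-! ### Permutation-symmetric operators and the action of the total spin -/

/-- The number of occurrences of a letter in a word. -/
def cnt {n : ℕ} (w : Fin n → Fin 4) (a : Fin 4) : ℕ := #{i | w i = a}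

theorem cnt_update {n : ℕ} (w : Fin n → Fin 4) (i : Fin n) (b a : Fin 4) :
    cnt (Function.update w i b) a =
      (cnt w a - if w i = a then 1 else 0) + if b = a then 1 else 0 := by
  have key : ∀ u : Fin n → Fin 4, cnt u a = (if u i = a then 1 else 0) +
      #{j ∈ univ.erase i | u j = a} := by
    intro u
    simp only [cnt, Finset.card_filter]
    rw [← Finset.add_sum_erase _ _ (Finset.mem_univ i)]
  rw [key, key w, Function.update_self, add_tsub_cancel_left, add_comm]
  congr 2
  refine Finset.filter_congr fun j hj => ?_
  rw [Function.update_of_ne (Finset.ne_of_mem_erase hj)]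

theorem sum_letters {n : ℕ} (w : Fin n → Fin 4) (G : Fin 4 → ℂ) :
    ∑ i, G (w i) = ∑ a, (cnt w a : ℂ) * G a := by
  rw [← Finset.sum_fiberwise' univ w G]
  simp [cnt]

theorem cnt_sum {n : ℕ} (w : Fin n → Fin 4) :
    cnt w 0 + cnt w 1 + cnt w 2 + cnt w 3 = n := by
  have h := Finset.card_eq_sum_card_fiberwise (f := w) (s := univ) (t := univ) (by simp)
  rw [Fin.sum_univ_four] at h
  simpa [cnt] using h.symm

/-- The permutation-symmetric combination of Pauli strings with given coefficients. -/
def symOp (n : ℕ) (f : ℕ → ℕ → ℕ → ℂ) : Op n :=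
  ∑ w : Fin n → Fin 4, f (cnt w 1) (cnt w 2) (cnt w 3) • pauliString w

/-- The sum of one Pauli matrix over all qubits. -/
def totalPauli (n : ℕ) (v : Fin 3) : Op n := ∑ i, onQubit (pauli v) i

/-- The action of `totalPauli` on the coefficients of `symOp`. -/
def symAct (n : ℕ) (f : ℕ → ℕ → ℕ → ℂ) : Fin 3 → ℕ → ℕ → ℕ → ℂ :=
  ![fun a b c => ((n : ℂ) - a - b - c) * f (a + 1) b c + a * f (a - 1) b c
      - Complex.I * b * f a (b - 1) (c + 1) + Complex.I * c * f a (b + 1) (c - 1),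
    fun a b c => ((n : ℂ) - a - b - c) * f a (b + 1) c + b * f a (b - 1) c
      + Complex.I * a * f (a - 1) b (c + 1) - Complex.I * c * f (a + 1) b (c - 1),
    fun a b c => ((n : ℂ) - a - b - c) * f a b (c + 1) + c * f a b (c - 1)
      - Complex.I * a * f (a - 1) (b + 1) c + Complex.I * b * f (a + 1) (b - 1) c]

/-- A Pauli matrix at qubit `i` permutes the strings up to phase, changing only the letter there.
The new coefficient of `w` thus depends only on letter counts. The truncated differences in `symAct`
are harmless: each comes with a factor that vanishes when the subtraction truncates. -/
theorem totalPauli_mul_symOp (n : ℕ) (v : Fin 3) (f : ℕ → ℕ → ℕ → ℂ) :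
    totalPauli n v * symOp n f = symOp n (symAct n f v) := by
  have one : ∀ i : Fin n, onQubit (pauli v) i * symOp n f = ∑ w : Fin n → Fin 4,
      (letterPhase v (letterMul v (w i)) *
        f (cnt (Function.update w i (letterMul v (w i))) 1)
          (cnt (Function.update w i (letterMul v (w i))) 2)
          (cnt (Function.update w i (letterMul v (w i))) 3)) • pauliString w := by
    intro i
    -- Multiplying the letter at `i` twice by the same Pauli matrix restores it, so the sum over
    -- words can be reindexed by this involution.
    have inv : Function.Involutive
        fun w : Fin n → Fin 4 => Function.update w i (letterMul v (w i)) := by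
      intro w
      simp [letterMul_letterMul]
    rw [symOp, Finset.mul_sum]
    rw [← Equiv.sum_comp (inv.toPerm _)]
    refine Finset.sum_congr rfl fun w _ => ?_
    simp only [Function.Involutive.coe_toPerm, Matrix.mul_smul, onQubit_mul_pauliString, smul_smul,
      Function.update_self, Function.update_idem, letterMul_letterMul, Function.update_eq_self]
    rw [mul_comm]
  rw [totalPauli, Finset.sum_mul, Finset.sum_congr rfl fun i _ => one i, Finset.sum_comm, symOp]
  refine Finset.sum_congr rfl fun w _ => ?_
  rw [← Finset.sum_smul]
  congr 1
  simp only [cnt_update]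
  rw [sum_letters w fun a => letterPhase v (letterMul v a) *
    f ((cnt w 1 - if a = 1 then 1 else 0) + if letterMul v a = 1 then 1 else 0)
      ((cnt w 2 - if a = 2 then 1 else 0) + if letterMul v a = 2 then 1 else 0)
      ((cnt w 3 - if a = 3 then 1 else 0) + if letterMul v a = 3 then 1 else 0)]
  have h0 : (cnt w 0 : ℂ) = n - cnt w 1 - cnt w 2 - cnt w 3 := by
    have h := congrArg (Nat.cast : ℕ → ℂ) (cnt_sum w)
    push_cast at h
    linear_combination h
  rw [Fin.sum_univ_four, h0]
  fin_cases v <;> simp [letterMul, letterPhase, symAct] <;> ring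

/-! ### Gaussian coefficients and the three-term recursion -/

/-- The moments of a standard Gaussian variable. -/
def gaussMoment : ℕ → ℂ
  | 0 => 1
  | 1 => 0
  | k + 2 => (k + 1) * gaussMoment k

theorem mul_gaussMoment_pred (a : ℕ) : (a : ℂ) * gaussMoment (a - 1) = gaussMoment (a + 1) := by
  cases a with
  | zero => simp [gaussMoment]
  | succ k => simp [gaussMoment]

theorem gaussMoment_add_two (a : ℕ) : gaussMoment (a + 1 + 1) = (a + 1) * gaussMoment a := rfl

/-- The coefficient of a Pauli string with letter counts `a, b, c` in `cOp n l`. -/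
def coef (l a b c : ℕ) : ℂ :=
  if a + b + c = l then gaussMoment a * gaussMoment b * gaussMoment c else 0

/-- The coefficients of the components of the vector operators in `J_v C_l`. -/
def vecCoef (l : ℕ) : Fin 3 → ℕ → ℕ → ℕ → ℂ :=
  ![fun a b c => if a + b + c = l then gaussMoment (a + 1) * gaussMoment b * gaussMoment c else 0,
    fun a b c => if a + b + c = l then gaussMoment a * gaussMoment (b + 1) * gaussMoment c else 0,
    fun a b c => if a + b + c = l then gaussMoment a * gaussMoment b * gaussMoment (c + 1) else 0]

theorem symOp_add (n : ℕ) (f g : ℕ → ℕ → ℕ → ℂ) :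
    symOp n (fun a b c => f a b c + g a b c) = symOp n f + symOp n g := by
  simp only [symOp, add_smul, Finset.sum_add_distrib]

theorem symOp_smul (n : ℕ) (r : ℂ) (f : ℕ → ℕ → ℕ → ℂ) :
    symOp n (fun a b c => r * f a b c) = r • symOp n f := by
  simp only [symOp, mul_smul, Finset.smul_sum]

theorem natCast_mul_ite_pred {a s l : ℕ} (x : ℂ) :
    (a : ℂ) * (if a - 1 + s = l then x else 0) = if a + s = l + 1 then a * x else 0 := by
  cases a with
  | zero => simp
  | succ k => simp [show k + 1 + s = l + 1 ↔ k + s = l by omega]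

theorem natCast_mul_ite_pred_succ {a s l : ℕ} (x : ℂ) :
    (a : ℂ) * (if a - 1 + (s + 1) = l then x else 0) = if a + s = l then a * x else 0 := by
  cases a with
  | zero => simp
  | succ k => simp [show k + 1 + s = l ↔ k + (s + 1) = l by omega]

theorem coef_pred (l a b c : ℕ) : (a : ℂ) * coef l (a - 1) b c = vecCoef (l + 1) 0 a b c := by
  simp only [coef, vecCoef, Matrix.cons_val_zero, add_assoc]
  rw [natCast_mul_ite_pred, ← mul_gaussMoment_pred a]
  simp only [mul_assoc]

theorem coef_comm (l a b c : ℕ) : coef l a b c = coef l b a c := by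
  simp only [coef, add_comm a b, mul_comm (gaussMoment a)]

theorem coef_comm' (l a b c : ℕ) : coef l a b c = coef l a c b := by
  simp only [coef, add_assoc, add_comm b c, mul_assoc, mul_comm (gaussMoment b)]

/-- Rotation invariance about one axis: by the moment identity, both sides become `x * gaussMoment
(b + 1) * gaussMoment (c + 1)` on the same support. This cancels the imaginary terms of `symAct`. -/
theorem rot_symm (x : ℂ) (s l b c : ℕ) :
    (b : ℂ) * (if s + (b - 1) + (c + 1) = l then
        x * gaussMoment (b - 1) * gaussMoment (c + 1) else 0) =
      (c : ℂ) * (if s + (b + 1) + (c - 1) = l then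
        x * gaussMoment (b + 1) * gaussMoment (c - 1) else 0) := by
  rw [show s + (b - 1) + (c + 1) = b - 1 + (s + c + 1) by omega,
    show s + (b + 1) + (c - 1) = c - 1 + (s + b + 1) by omega, natCast_mul_ite_pred_succ,
    natCast_mul_ite_pred_succ, ← mul_gaussMoment_pred b, ← mul_gaussMoment_pred c,
    show b + (s + c) = c + (s + b) by omega]
  congr 1
  ring

theorem coef_rot (l a b c : ℕ) :
    (b : ℂ) * coef l a (b - 1) (c + 1) = (c : ℂ) * coef l a (b + 1) (c - 1) :=
  rot_symm _ _ _ _ _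

theorem vecCoef_rot (l a b c : ℕ) :
    (b : ℂ) * vecCoef l 0 a (b - 1) (c + 1) = (c : ℂ) * vecCoef l 0 a (b + 1) (c - 1) :=
  rot_symm _ _ _ _ _

theorem vecCoef_one (l a b c : ℕ) : vecCoef l 1 a b c = vecCoef l 0 b a c := by
  simp [vecCoef, add_comm a b, mul_comm (gaussMoment a)]

theorem vecCoef_two (l a b c : ℕ) : vecCoef l 2 a b c = vecCoef l 0 c a b := by
  simp only [vecCoef, Matrix.cons_val]
  rw [show c + a + b = a + b + c by omega]
  congr 1
  ring

theorem symAct_coef_aux (n l : ℕ) (v : Fin 3) (a b c : ℕ) :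
    symAct n (coef l) v a b c = ((n : ℂ) - a - b - c) *
      ![coef l (a + 1) b c, coef l (b + 1) a c, coef l (c + 1) a b] v
        + vecCoef (l + 1) v a b c := by
  fin_cases v
  · have h2 := coef_pred l a b c
    have h3 := coef_rot l a b c
    simp only [symAct, Matrix.cons_val_zero, Fin.zero_eta]
    linear_combination h2 - Complex.I * h3
  · have h2 := coef_pred l b a c
    have h3 := coef_rot l b a c
    rw [coef_comm l (b - 1)] at h2
    rw [coef_comm l b, coef_comm l b] at h3
    simp only [symAct, Matrix.cons_val_one, Fin.mk_one, vecCoef_one, coef_comm l (b + 1)]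
    simp only [Matrix.cons_val]
    linear_combination h2 + Complex.I * h3
  · have h2 := coef_pred l c a b
    have h3 := coef_rot l c a b
    rw [coef_comm l (c - 1), coef_comm' l a (c - 1)] at h2
    rw [coef_comm l c, coef_comm' l _ c, coef_comm l c, coef_comm' l _ c] at h3
    simp only [Fin.reduceFinMk, vecCoef_two]
    simp only [symAct, Matrix.cons_val, coef_comm l (c + 1), coef_comm' l a (c + 1)]
    linear_combination h2 - Complex.I * h3

theorem symAct_coef (n l : ℕ) (v : Fin 3) (a b c : ℕ) :
    symAct n (coef (l + 1)) v a b c =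
      ((n : ℂ) - l) * vecCoef l v a b c + vecCoef (l + 2) v a b c := by
  have main : ∀ a b c : ℕ, ((n : ℂ) - a - b - c) * coef (l + 1) (a + 1) b c =
      ((n : ℂ) - l) * vecCoef l 0 a b c := by
    intro a b c
    simp only [coef, vecCoef, Matrix.cons_val_zero,
      show a + 1 + b + c = l + 1 ↔ a + b + c = l by omega]
    split_ifs with h
    · rw [← h]; push_cast; ring
    · simp
  rw [symAct_coef_aux]
  congr 1
  fin_cases v
  · exact main a b c
  · refine Eq.trans ?_ ((main b a c).trans (congrArg _ (vecCoef_one l a b c).symm))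
    simp only [Fin.mk_one, Matrix.cons_val_one, Matrix.cons_val_zero]
    ring
  · refine Eq.trans ?_ ((main c a b).trans (congrArg _ (vecCoef_two l a b c).symm))
    simp only [Fin.reduceFinMk, Matrix.cons_val]
    ring

theorem symAct_coef_zero (n : ℕ) (v : Fin 3) (a b c : ℕ) :
    symAct n (coef 0) v a b c = vecCoef 1 v a b c := by
  rw [symAct_coef_aux]
  fin_cases v <;> simp [coef]

theorem symAct_vecCoef_zero (n l a b c : ℕ) :
    symAct n (vecCoef (l + 1) 0) 0 a b c =
      ((n : ℂ) - l) * (a + 1) * coef l a b c + a * coef (l + 2) a b c := by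
  have h1 : ((n : ℂ) - a - b - c) * vecCoef (l + 1) 0 (a + 1) b c =
      ((n : ℂ) - l) * (a + 1) * coef l a b c := by
    simp only [coef, vecCoef, Matrix.cons_val_zero, gaussMoment_add_two,
      show a + 1 + b + c = l + 1 ↔ a + b + c = l by omega]
    split_ifs with h
    · rw [← h]; push_cast; ring
    · simp
  have h2 : (a : ℂ) * vecCoef (l + 1) 0 (a - 1) b c = a * coef (l + 2) a b c := by
    cases a with
    | zero => simp
    | succ k =>
      simp only [coef, vecCoef, Matrix.cons_val_zero, Nat.add_sub_cancel,
        show k + 1 + b + c = l + 2 ↔ k + b + c = l + 1 by omega]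
  have h3 := vecCoef_rot (l + 1) a b c
  simp only [symAct, Matrix.cons_val_zero]
  linear_combination h1 + h2 - Complex.I * h3

/-- Exchanging two axes reverses orientation and flips the sign of the imaginary terms, but these
cancel by `vecCoef_rot`. The cyclic relabelling in `symAct_vecCoef_two` causes no flip. -/
theorem symAct_vecCoef_one (n l a b c : ℕ) :
    symAct n (vecCoef l 1) 1 a b c = symAct n (vecCoef l 0) 0 b a c := by
  have h3 := vecCoef_rot l b a c
  simp only [symAct, Matrix.cons_val_zero, Matrix.cons_val_one, vecCoef_one]
  linear_combination 2 * Complex.I * h3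

theorem symAct_vecCoef_two (n l a b c : ℕ) :
    symAct n (vecCoef l 2) 2 a b c = symAct n (vecCoef l 0) 0 c a b := by
  simp only [symAct, Matrix.cons_val, Matrix.cons_val_zero, vecCoef_two]
  ring

theorem sum_symAct_vecCoef (n l a b c : ℕ) :
    ∑ v, symAct n (vecCoef (l + 1) v) v a b c =
      ((n : ℂ) - l) * (l + 3) * coef l a b c + ((l : ℂ) + 2) * coef (l + 2) a b c := by
  rw [Fin.sum_univ_three, symAct_vecCoef_one, symAct_vecCoef_two, symAct_vecCoef_zero,
    symAct_vecCoef_zero, symAct_vecCoef_zero, coef_comm _ b a c, coef_comm _ b a c,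
    coef_comm _ c a b, coef_comm' _ a c b, coef_comm _ c a b, coef_comm' _ a c b]
  have h (m : ℕ) : ((a : ℂ) + b + c) * coef m a b c = m * coef m a b c := by
    simp only [coef]
    split_ifs with h
    · rw [← h]; push_cast; ring
    · simp
  have h2 := h (l + 2)
  push_cast at h2
  linear_combination ((n : ℂ) - l) * h l + h2

/-- The permutation-symmetric operator that turns out to be `cOp n l` for even `l`. -/
def symC (n l : ℕ) : Op n := symOp n (coef l)

/-- The vector operator `V_v` in `J_v C_l`. -/
def symV (n l : ℕ) (v : Fin 3) : Op n := symOp n (vecCoef l v)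

theorem totalPauli_mul_symC (n l : ℕ) (v : Fin 3) :
    totalPauli n v * symC n (l + 1) = ((n : ℂ) - l) • symV n l v + symV n (l + 2) v := by
  rw [symC, totalPauli_mul_symOp, symV, symV, ← symOp_smul, ← symOp_add]
  congr 1
  funext a b c
  exact symAct_coef n l v a b c

theorem totalPauli_mul_symC_zero (n : ℕ) (v : Fin 3) :
    totalPauli n v * symC n 0 = symV n 1 v := by
  rw [symC, totalPauli_mul_symOp, symV]
  congr 1
  funext a b c
  exact symAct_coef_zero n v a b c

theorem sum_totalPauli_mul_symV (n l : ℕ) :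
    ∑ v, totalPauli n v * symV n (l + 1) v =
      (((n : ℂ) - l) * (l + 3)) • symC n l + ((l : ℂ) + 2) • symC n (l + 2) := by
  simp only [symV, symC, totalPauli_mul_symOp]
  rw [← symOp_smul, ← symOp_smul, ← symOp_add]
  simp only [symOp]
  rw [Finset.sum_comm]
  refine Finset.sum_congr rfl fun w _ => ?_
  rw [← Finset.sum_smul, sum_symAct_vecCoef]

theorem symC_zero (n : ℕ) : symC n 0 = 1 := by
  rw [symC, symOp, Finset.sum_eq_single (fun _ => 0)]
  · simp [coef, cnt, gaussMoment, pauliString_zero]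
  · intro w _ hw
    suffices coef 0 (cnt w 1) (cnt w 2) (cnt w 3) = 0 by rw [this, zero_smul]
    rw [coef, if_neg]
    intro h
    apply hw
    funext i
    have h1 : cnt w 1 = 0 := by omega
    have h2 : cnt w 2 = 0 := by omega
    have h3 : cnt w 3 = 0 := by omega
    simp only [cnt, Finset.card_eq_zero, Finset.filter_eq_empty_iff, Finset.mem_univ,
      forall_const] at h1 h2 h3
    have h1 := @h1 i
    have h2 := @h2 i
    have h3 := @h3 i
    revert h1 h2 h3
    generalize w i = x
    revert x
    decide
  · simp

theorem four_smul_angMomSq (n : ℕ) : (4 : ℂ) • angMomSq n = ∑ v, totalPauli n v ^ 2 := by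
  rw [angMomSq, Finset.smul_sum]
  refine Finset.sum_congr rfl fun v _ => ?_
  rw [angMom, smul_pow, smul_smul, totalPauli]
  norm_num

/-- The case `l = 0` of the vector recursion, with the total spin acting twice on `symC n 0 = 1`. -/
theorem four_smul_angMomSq_eq (n : ℕ) :
    (4 : ℂ) • angMomSq n = (2 : ℂ) • symC n 2 + (3 * n : ℂ) • (1 : Op n) := by
  have h := sum_totalPauli_mul_symV n 0
  simp only [zero_add, ← totalPauli_mul_symC_zero, symC_zero, mul_one] at h
  rw [four_smul_angMomSq]
  simp only [pow_two, h, Nat.cast_zero, sub_zero, zero_add]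
  rw [add_comm, mul_comm]

/-- Since `2 C_2 = ∑_v (∑_i σ_i^(v))² - 3n`, it suffices to apply the total spin twice. The first
application splits `C_{l+2}` into vector operators of degrees `l + 1` and `l + 3`; the second
contracts each of them to scalars of adjacent even shift. -/
theorem symC_two_mul_symC (n l : ℕ) :
    symC n 2 * symC n (l + 2) = ((l : ℂ) / 2 + 2) • symC n (l + 4) +
      (((n : ℂ) - l - 3) * (l + 2)) • symC n (l + 2) +
      ((l + 3) * ((n - l) * (n - l - 1) / 2) : ℂ) • symC n l := by
  have h : (2 : ℂ) • symC n 2 = ∑ v, totalPauli n v ^ 2 - (3 * n : ℂ) • (1 : Op n) := by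
    rw [← four_smul_angMomSq, four_smul_angMomSq_eq, add_sub_cancel_right]
  have h1 : (∑ v, totalPauli n v ^ 2) * symC n (l + 2) =
      ((n : ℂ) - (l + 1)) • ((((n : ℂ) - l) * (l + 3)) • symC n l
        + ((l : ℂ) + 2) • symC n (l + 2)) +
      ((((n : ℂ) - (l + 2)) * (l + 5)) • symC n (l + 2) + ((l : ℂ) + 4) • symC n (l + 4)) := by
    have e1 := sum_totalPauli_mul_symV n l
    have e2 := sum_totalPauli_mul_symV n (l + 2)
    have e3 : ((l + 2 : ℕ) : ℂ) + 3 = l + 5 := by push_cast; ring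
    have e4 : ((l + 2 : ℕ) : ℂ) + 2 = l + 4 := by push_cast; ring
    rw [e3, e4, Nat.cast_add, Nat.cast_ofNat] at e2
    rw [← e1, ← e2, Finset.sum_mul, Finset.smul_sum, ← Finset.sum_add_distrib]
    refine Finset.sum_congr rfl fun v _ => ?_
    rw [pow_two, mul_assoc, totalPauli_mul_symC, mul_add, Matrix.mul_smul, Nat.cast_add,
      Nat.cast_one]
  have h2 : symC n 2 = (1 / 2 : ℂ) • ((2 : ℂ) • symC n 2) := by
    rw [smul_smul]; norm_num
  rw [h2, h, smul_mul_assoc, sub_mul, h1, smul_mul_assoc, one_mul]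
  module

/-! ### Identification of `C_l` with the Gaussian-coefficient operator -/

theorem exchange_mul_pauliString {n : ℕ} {r s : Fin n} (hrs : r ≠ s) {w : Fin n → Fin 4}
    (hr : w r = 0) (hs : w s = 0) :
    exchange r s * pauliString w = (1 / 2 : ℂ) • ∑ v : Fin 3,
      pauliString (Function.update (Function.update w s v.succ) r v.succ) := by
  rw [exchange, smul_mul_assoc, Finset.sum_mul]
  congr 1
  refine Finset.sum_congr rfl fun v _ => ?_
  have h1 : letterPhase v 0 = 1 := by fin_cases v <;> rfl
  have h2 : letterMul v 0 = v.succ := by fin_cases v <;> rfl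
  rw [mul_assoc, onQubit_mul_pauliString, hs, h1, h2, one_smul, onQubit_mul_pauliString,
    Function.update_of_ne hrs, hr, h1, h2, one_smul]

/-- The part of `symC n l` supported on the qubits in `S`. -/
def symCOn {n : ℕ} (S : Finset (Fin n)) (l : ℕ) : Op n :=
  ∑ w : Fin n → Fin 4 with ∀ i, w i ≠ 0 → i ∈ S,
    coef l (cnt w 1) (cnt w 2) (cnt w 3) • pauliString w

theorem symCOn_univ (n l : ℕ) : symCOn (univ : Finset (Fin n)) l = symC n l := by
  simp [symCOn, symC, symOp]

/-- The word `w` with the letters at `r` and `s` erased. -/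
def eraseTwo {n : ℕ} (w : Fin n → Fin 4) (r s : Fin n) : Fin n → Fin 4 :=
  Function.update (Function.update w s 0) r 0

/-- The second factor is the identity on `r` and `s`, so no phases arise: the exchange writes one
common letter at both places, and erasing the two letters inverts this. -/
theorem exchange_mul_symCOn {n : ℕ} (S : Finset (Fin n)) (l : ℕ) {r s : Fin n} (hrs : r ≠ s)
    (hr : r ∈ S) (hs : s ∈ S) :
    exchange r s * symCOn ((S.erase r).erase s) l = (1 / 2 : ℂ) •
      ∑ w : Fin n → Fin 4 with ∀ i, w i ≠ 0 → i ∈ S,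
        (∑ v : Fin 3, if w r = v.succ ∧ w s = v.succ then
          coef l (cnt (eraseTwo w r s) 1) (cnt (eraseTwo w r s) 2) (cnt (eraseTwo w r s) 3)
        else 0) • pauliString w := by
  have h1 : exchange r s * symCOn ((S.erase r).erase s) l = (1 / 2 : ℂ) • ∑ v : Fin 3,
      ∑ w : Fin n → Fin 4 with ∀ i, w i ≠ 0 → i ∈ (S.erase r).erase s,
        coef l (cnt w 1) (cnt w 2) (cnt w 3) •
          pauliString (Function.update (Function.update w s v.succ) r v.succ) := by
    rw [symCOn, Finset.mul_sum, Finset.sum_comm, Finset.smul_sum]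
    refine Finset.sum_congr rfl fun w hw => ?_
    have hw := (Finset.mem_filter.mp hw).2
    have h0 : w r = 0 := by
      by_contra h
      simpa using hw r h
    have h0' : w s = 0 := by
      by_contra h
      simpa using hw s h
    rw [Matrix.mul_smul, exchange_mul_pauliString hrs h0 h0', smul_comm, Finset.smul_sum]
  rw [h1]
  congr 1
  simp_rw [Finset.sum_smul]
  rw [Finset.sum_comm (s := {w : Fin n → Fin 4 | ∀ i, w i ≠ 0 → i ∈ S})]
  refine Finset.sum_congr rfl fun v _ => ?_
  simp_rw [ite_smul, zero_smul]
  rw [← Finset.sum_filter]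
  refine Finset.sum_nbij' (fun w => Function.update (Function.update w s v.succ) r v.succ)
    (fun w => eraseTwo w r s) ?_ ?_ ?_ ?_ ?_
  · intro w hw
    have hw := (Finset.mem_filter.mp hw).2
    simp only [Finset.mem_filter, Finset.mem_univ, true_and, Function.update_self,
      Function.update_of_ne hrs.symm, and_true]
    intro i hi
    by_cases h1 : i = r
    · exact h1 ▸ hr
    by_cases h2 : i = s
    · exact h2 ▸ hs
    rw [Function.update_of_ne h1, Function.update_of_ne h2] at hi
    exact Finset.mem_of_mem_erase (Finset.mem_of_mem_erase (hw i hi))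
  · intro w hw
    simp only [Finset.mem_filter, Finset.mem_univ, true_and] at hw ⊢
    intro i hi
    have h1 : i ≠ r := by
      rintro rfl
      simp [eraseTwo] at hi
    have h2 : i ≠ s := by
      rintro rfl
      simp [eraseTwo, hrs.symm] at hi
    simp only [eraseTwo, Function.update_of_ne h1, Function.update_of_ne h2] at hi
    simp [h1, h2, hw.1 i hi]
  · intro w hw
    have hw := (Finset.mem_filter.mp hw).2
    have h0 : w r = 0 := by
      by_contra h
      simpa using hw r h
    have h0' : w s = 0 := by
      by_contra h
      simpa using hw s h
    funext i
    by_cases h1 : i = r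
    · subst h1; simp [eraseTwo, h0]
    by_cases h2 : i = s
    · subst h2; simp [eraseTwo, h0', hrs.symm]
    simp [eraseTwo, h1, h2]
  · intro w hw
    have hw := (Finset.mem_filter.mp hw).2
    funext i
    by_cases h1 : i = r
    · subst h1; simp [hw.1]
    by_cases h2 : i = s
    · subst h2; simp [hw.2, hrs.symm]
    simp [eraseTwo, h1, h2]
  · intro w hw
    have hw := (Finset.mem_filter.mp hw).2
    have h0 : w r = 0 := by
      by_contra h
      simpa using hw r h
    have h0' : w s = 0 := by
      by_contra h
      simpa using hw s h
    suffices eraseTwo (Function.update (Function.update w s v.succ) r v.succ) r s = w by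
      rw [this]
    funext i
    by_cases h1 : i = r
    · subst h1; simp [eraseTwo, h0]
    by_cases h2 : i = s
    · subst h2; simp [eraseTwo, h0', hrs.symm]
    simp [eraseTwo, h1, h2]

theorem cnt_eraseTwo {n : ℕ} (w : Fin n → Fin 4) {r s : Fin n} (hrs : r ≠ s) {x : Fin 4}
    (hr : w r = x) (hs : w s = x) {a : Fin 4} (ha : a ≠ 0) :
    cnt (eraseTwo w r s) a = cnt w a - if x = a then 2 else 0 := by
  rw [eraseTwo, cnt_update, cnt_update, Function.update_of_ne hrs, hr, hs, if_neg ha.symm]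
  split_ifs <;> omega

theorem sum_pairs_eq {n : ℕ} (w : Fin n → Fin 4) (x : Fin 4) (c : ℂ) :
    ∑ r, ∑ s, (if r ≠ s ∧ w r = x ∧ w s = x then c else 0) =
      (cnt w x : ℂ) * ((cnt w x : ℂ) - 1) * c := by
  have h : ∀ r s : Fin n, (if r ≠ s ∧ w r = x ∧ w s = x then c else 0) =
      (if w r = x then (1 : ℂ) else 0) * ((if w s = x then c else 0) - if r = s then c else 0) := by
    intro r s
    by_cases h1 : r = s
    · subst h1; by_cases h2 : w r = x <;> simp [h2]
    · by_cases h2 : w r = x <;> simp [h1, h2]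
  simp_rw [h, ← Finset.mul_sum, Finset.sum_sub_distrib, Finset.sum_ite_eq, Finset.mem_univ,
    if_true, ← Finset.sum_mul, ← Finset.sum_filter, Finset.sum_const, nsmul_eq_mul, cnt]
  ring

theorem mul_coef_sub_two (l a b c : ℕ) :
    (a : ℂ) * ((a : ℂ) - 1) * coef l (a - 2) b c = a * coef (l + 2) a b c := by
  rcases a with _ | _ | a
  · simp
  · simp [coef, gaussMoment]
  · simp only [coef, gaussMoment,
      show a + 1 + 1 + b + c = l + 2 ↔ a + b + c = l by omega]
    push_cast
    split_ifs <;> ring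

theorem sum_coef_eraseTwo {n : ℕ} (l : ℕ) (w : Fin n → Fin 4) :
    ∑ r, ∑ s, (if r ≠ s then ∑ v : Fin 3, (if w r = v.succ ∧ w s = v.succ then
          coef l (cnt (eraseTwo w r s) 1) (cnt (eraseTwo w r s) 2) (cnt (eraseTwo w r s) 3)
        else 0) else 0) = ((l : ℂ) + 2) * coef (l + 2) (cnt w 1) (cnt w 2) (cnt w 3) := by
  have h1 : ∀ r s : Fin n, (if r ≠ s then ∑ v : Fin 3, (if w r = v.succ ∧ w s = v.succ then
          coef l (cnt (eraseTwo w r s) 1) (cnt (eraseTwo w r s) 2) (cnt (eraseTwo w r s) 3)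
        else 0) else 0) = ∑ v : Fin 3, (if r ≠ s ∧ w r = v.succ ∧ w s = v.succ then
          coef l (cnt w 1 - if v.succ = 1 then 2 else 0) (cnt w 2 - if v.succ = 2 then 2 else 0)
            (cnt w 3 - if v.succ = 3 then 2 else 0) else 0) := by
    intro r s
    by_cases hrs : r = s
    · simp [hrs]
    rw [if_pos hrs]
    refine Finset.sum_congr rfl fun v _ => ?_
    by_cases h : w r = v.succ ∧ w s = v.succ
    · rw [if_pos h, if_pos ⟨hrs, h⟩]
      simp only [cnt_eraseTwo w hrs h.1 h.2, ne_eq, one_ne_zero,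
        not_false_eq_true, Fin.reduceEq]
    · rw [if_neg h, if_neg fun h' => h h'.2]
  simp_rw [h1]
  have h2 : ∀ f : Fin n → Fin n → Fin 3 → ℂ,
      ∑ r, ∑ s, ∑ v, f r s v = ∑ v, ∑ r, ∑ s, f r s v := by
    intro f
    exact (Finset.sum_congr rfl fun r _ => Finset.sum_comm).trans Finset.sum_comm
  rw [h2]
  simp_rw [sum_pairs_eq]
  rw [Fin.sum_univ_three]
  simp only [Fin.succ_zero_eq_one, Fin.succ_one_eq_two, Fin.isValue, ↓reduceIte, Fin.reduceEq,
    show Fin.succ (2 : Fin 3) = 3 from rfl, tsub_zero]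
  have e1 := mul_coef_sub_two l (cnt w 1) (cnt w 2) (cnt w 3)
  have e2 := mul_coef_sub_two l (cnt w 2) (cnt w 1) (cnt w 3)
  have e3 := mul_coef_sub_two l (cnt w 3) (cnt w 1) (cnt w 2)
  rw [coef_comm, coef_comm (l + 2)] at e2
  rw [coef_comm, coef_comm', coef_comm (l + 2), coef_comm' (l + 2)] at e3
  have h (m a b c : ℕ) : ((a : ℂ) + b + c) * coef m a b c = m * coef m a b c := by
    simp only [coef]
    split_ifs with h
    · rw [← h]; push_cast; ring
    · simp
  have h4 := h (l + 2) (cnt w 1) (cnt w 2) (cnt w 3)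
  push_cast at h4
  linear_combination e1 + e2 + e3 + h4

/-- Removing a pair of equal letters: a word arises from `a (a - 1)` ordered pairs of x letters, and
`a (a - 1) g (a - 2) = a g a`. The three letters together contribute `a + b + c = l + 2`. -/
theorem sum_exchange_mul_symCOn {n : ℕ} (S : Finset (Fin n)) (l : ℕ) :
    ∑ r, ∑ s, (if r ≠ s ∧ r ∈ S ∧ s ∈ S then
      exchange r s * symCOn ((S.erase r).erase s) l else 0) =
      (((l : ℂ) + 2) / 2) • symCOn S (l + 2) := by
  have h1 : ∀ r s : Fin n, (if r ≠ s ∧ r ∈ S ∧ s ∈ S then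
      exchange r s * symCOn ((S.erase r).erase s) l else 0) = (1 / 2 : ℂ) •
      ∑ w : Fin n → Fin 4 with ∀ i, w i ≠ 0 → i ∈ S,
        (if r ≠ s then ∑ v : Fin 3, (if w r = v.succ ∧ w s = v.succ then
          coef l (cnt (eraseTwo w r s) 1) (cnt (eraseTwo w r s) 2) (cnt (eraseTwo w r s) 3)
        else 0) else 0) • pauliString w := by
    intro r s
    by_cases hrs : r = s
    · simp [hrs]
    by_cases h : r ∈ S ∧ s ∈ S
    · rw [if_pos ⟨hrs, h⟩, exchange_mul_symCOn S l hrs h.1 h.2]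
      simp only [ne_eq, hrs, not_false_eq_true, if_true]
    · rw [if_neg fun h' => h h'.2, Finset.sum_eq_zero, smul_zero]
      intro w hw
      have hw := (Finset.mem_filter.mp hw).2
      rw [if_pos hrs, Finset.sum_eq_zero, zero_smul]
      intro v _
      rw [if_neg]
      rintro ⟨h2, h3⟩
      exact h ⟨hw r (h2 ▸ Fin.succ_ne_zero v), hw s (h3 ▸ Fin.succ_ne_zero v)⟩
  simp_rw [h1, ← Finset.smul_sum]
  have h2 : ∀ (T : Finset (Fin n → Fin 4)) (f : Fin n → Fin n → (Fin n → Fin 4) → ℂ),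
      ∑ r, ∑ s, ∑ w ∈ T, f r s w • pauliString w =
        ∑ w ∈ T, (∑ r, ∑ s, f r s w) • pauliString w := by
    intro T f
    simp_rw [Finset.sum_smul]
    rw [Finset.sum_comm (s := T)]
    refine Finset.sum_congr rfl fun r _ => ?_
    rw [Finset.sum_comm]
  rw [h2]
  simp_rw [sum_coef_eraseTwo, mul_smul, ← Finset.smul_sum]
  rw [smul_smul, symCOn]
  congr 1
  ring

theorem symCOn_zero {n : ℕ} (S : Finset (Fin n)) : symCOn S 0 = 1 := by
  rw [← symC_zero, ← symCOn_univ, symCOn, symCOn]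
  refine Finset.sum_subset (fun w hw => by simp) fun w _ hw => ?_
  suffices coef 0 (cnt w 1) (cnt w 2) (cnt w 3) = 0 by rw [this, zero_smul]
  rw [coef, if_neg]
  intro h
  apply hw
  have h1 := cnt_sum w
  have h2 : cnt w 0 = #(univ : Finset (Fin n)) := by rw [Finset.card_fin]; omega
  rw [cnt, Finset.card_filter_eq_iff] at h2
  simp only [Finset.mem_filter, Finset.mem_univ, true_and]
  intro i hi
  exact absurd (h2 i (Finset.mem_univ i)) hi

theorem injective_cons_iff {n p : ℕ} (S : Finset (Fin n)) (x : Fin 2 → Fin n)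
    (g : Fin p → Fin 2 → Fin n) :
    (Function.Injective (fun q : Fin (p + 1) × Fin 2 =>
        (Fin.cons x g : Fin (p + 1) → Fin 2 → Fin n) q.1 q.2) ∧
      ∀ k b, (Fin.cons x g : Fin (p + 1) → Fin 2 → Fin n) k b ∈ S) ↔
    (x 0 ≠ x 1 ∧ x 0 ∈ S ∧ x 1 ∈ S) ∧
      (Function.Injective (fun q : Fin p × Fin 2 => g q.1 q.2) ∧
        ∀ k b, g k b ∈ (S.erase (x 0)).erase (x 1)) := by
  constructor
  · rintro ⟨hi, hS⟩
    refine ⟨⟨fun h => ?_, hS 0 0, hS 0 1⟩, fun q q' h => ?_, fun k b => ?_⟩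
    · simpa using @hi (0, 0) (0, 1) h
    · have := @hi (q.1.succ, q.2) (q'.1.succ, q'.2) h
      simp only [Prod.mk.injEq, Fin.succ_inj] at this
      exact Prod.ext this.1 this.2
    · simp only [Finset.mem_erase]
      refine ⟨fun h => ?_, fun h => ?_, hS k.succ b⟩
      · have := @hi (k.succ, b) (0, 1) h
        exact Fin.succ_ne_zero k (congrArg Prod.fst this)
      · have := @hi (k.succ, b) (0, 0) h
        exact Fin.succ_ne_zero k (congrArg Prod.fst this)
  · rintro ⟨⟨hx, h0, h1⟩, hi, hS⟩
    simp only [Finset.mem_erase] at hS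
    have hxb : ∀ b k b', x b ≠ g k b' := by
      intro b k b' h
      fin_cases b
      · exact (hS k b').2.1 h.symm
      · exact (hS k b').1 h.symm
    refine ⟨?_, fun k b => ?_⟩
    · rintro ⟨k, b⟩ ⟨k', b'⟩ h
      cases k using Fin.cases <;> cases k' using Fin.cases
      · simp only [Fin.cons_zero] at h
        fin_cases b <;> fin_cases b' <;> first | rfl | exact absurd h hx | exact absurd h.symm hx
      · exact absurd h (hxb _ _ _)
      · exact absurd h.symm (hxb _ _ _)
      · rename_i k k'
        have := @hi (k, b) (k', b') h
        simp only [Prod.mk.injEq] at this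
        rw [this.1, this.2]
    · cases k using Fin.cases
      · fin_cases b <;> assumption
      · exact (hS _ b).2.2

-- Peeling off the first pair `r, s` leaves tuples in `S` without `r, s`, which is why the induction
-- runs over all `S`. The factor `(2p + 2) / 2 = p + 1` from `sum_exchange_mul_symCOn` builds up the
-- factorial.
open Classical in
theorem sum_prod_exchange {n : ℕ} (p : ℕ) (S : Finset (Fin n)) :
    ∑ g : Fin p → Fin 2 → Fin n,
      (if Function.Injective (fun q : Fin p × Fin 2 => g q.1 q.2) ∧ ∀ k b, g k b ∈ S then
        (List.ofFn fun k => exchange (g k 0) (g k 1)).prod else 0) =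
      (p.factorial : ℂ) • symCOn S (2 * p) := by
  induction p generalizing S with
  | zero =>
    simp [symCOn_zero, Function.Injective]
  | succ p ih =>
    rw [← Equiv.sum_comp (Fin.consEquiv fun _ => Fin 2 → Fin n), Fintype.sum_prod_type,
      ← Equiv.sum_comp (finTwoArrowEquiv (Fin n)).symm, Fintype.sum_prod_type]
    simp only [Fin.consEquiv_apply, injective_cons_iff, List.ofFn_succ, List.prod_cons,
      Fin.cons_zero, Fin.cons_succ]
    have h : ∀ r s : Fin n, ∑ g : Fin p → Fin 2 → Fin n,
        (if (r ≠ s ∧ r ∈ S ∧ s ∈ S) ∧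
          (Function.Injective (fun q : Fin p × Fin 2 => g q.1 q.2) ∧
            ∀ k b, g k b ∈ (S.erase r).erase s) then
          exchange r s * (List.ofFn fun k => exchange (g k 0) (g k 1)).prod else 0) =
        (p.factorial : ℂ) • if r ≠ s ∧ r ∈ S ∧ s ∈ S then
          exchange r s * symCOn ((S.erase r).erase s) (2 * p) else 0 := by
      intro r s
      by_cases hc : r ≠ s ∧ r ∈ S ∧ s ∈ S
      · rw [if_pos hc, ← Matrix.mul_smul, ← ih, Finset.mul_sum]
        simp only [and_iff_right hc, mul_ite, mul_zero]
      · simp only [hc, false_and, if_false, Finset.sum_const_zero, smul_zero]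
    refine (Finset.sum_congr rfl fun r _ => Finset.sum_congr rfl fun s _ => h r s).trans ?_
    simp_rw [← Finset.smul_sum]
    rw [sum_exchange_mul_symCOn, smul_smul, mul_add_one]
    congr 1
    rw [Nat.factorial_succ]
    push_cast
    ring

theorem cOp_eq_symC (n p : ℕ) : cOp n (2 * p) = symC n (2 * p) := by
  classical
  have h := sum_prod_exchange p (univ : Finset (Fin n))
  simp only [Finset.mem_univ, implies_true, and_true, symCOn_univ] at h
  rw [← Equiv.sum_comp (Equiv.curry (Fin p) (Fin 2) (Fin n))] at h
  simp only [Equiv.curry_apply, Function.curry_apply] at h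
  rw [← Finset.sum_filter, Finset.sum_subtype (p := Function.Injective) _ (by simp),
    ← Equiv.sum_comp (Equiv.subtypeInjectiveEquivEmbedding (Fin p × Fin 2) (Fin n)).symm] at h
  rw [cOp, Nat.mul_div_cancel_left p two_pos]
  refine Eq.trans (congrArg _ h) ?_
  rw [smul_smul, one_div_mul_cancel (Nat.cast_ne_zero.mpr p.factorial_ne_zero), one_smul]

/-! ### `C_{2p}` as a polynomial in `J²` -/

open Polynomial

/-- The polynomial `P` with `C_{2p} = P(J²)`. -/
noncomputable def polyC (n : ℕ) : ℕ → ℝ[X]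
  | 0 => 1
  | 1 => C 2 * X - C (3 * (n : ℝ) / 2)
  | p + 2 => C (1 / ((p : ℝ) + 2)) *
      ((C 2 * X - C (3 * (n : ℝ) / 2 + (n - 2 * p - 3) * (2 * p + 2))) * polyC n (p + 1) -
        C ((2 * (p : ℝ) + 3) * ((n - 2 * p) * (n - 2 * p - 1) / 2)) * polyC n p)

/-- Each recursion step multiplies the leading coefficient by `2 / (p + 2)`, so it stays positive.
Two consecutive indices are carried because the recursion has order two. -/
theorem polyC_degree_aux (n p : ℕ) :
    ((polyC n p).natDegree ≤ p ∧ 0 < (polyC n p).coeff p) ∧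
    ((polyC n (p + 1)).natDegree ≤ p + 1 ∧ 0 < (polyC n (p + 1)).coeff (p + 1)) := by
  induction p with
  | zero =>
    refine ⟨by simp [polyC], ?_, ?_⟩
    · rw [polyC]; compute_degree
    · simp [polyC, coeff_C]
  | succ p ih =>
    refine ⟨ih.2, ?_, ?_⟩
    · rw [polyC]
      refine (natDegree_C_mul_le _ _).trans ((natDegree_sub_le _ _).trans (max_le ?_ ?_))
      · refine natDegree_mul_le.trans ?_
        have : (C 2 * X - C (3 * (n : ℝ) / 2 + (n - 2 * p - 3) * (2 * p + 2))).natDegree ≤ 1 := by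
          compute_degree
        have := ih.2.1
        omega
      · exact (natDegree_C_mul_le _ _).trans (ih.1.1.trans (by omega))
    · have h1 : (polyC n (p + 1)).coeff (p + 2) = 0 :=
        coeff_eq_zero_of_natDegree_lt (by have := ih.2.1; omega)
      have h2 : (polyC n p).coeff (p + 2) = 0 :=
        coeff_eq_zero_of_natDegree_lt (by have := ih.1.1; omega)
      rw [polyC, coeff_C_mul, coeff_sub, sub_mul, coeff_sub, coeff_C_mul, coeff_C_mul, h2,
        mul_assoc, coeff_C_mul, coeff_X_mul, h1]
      have := ih.2.2
      simp only [mul_zero, sub_zero]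
      positivity

theorem polyC_natDegree (n p : ℕ) : (polyC n p).natDegree = p :=
  natDegree_eq_of_le_of_coeff_ne_zero (polyC_degree_aux n p).1.1 (polyC_degree_aux n p).1.2.ne'

theorem real_smul_op {n : ℕ} (r : ℝ) (A : Op n) : r • A = (r : ℂ) • A := by
  ext x y
  simp

theorem aeval_C_op {n : ℕ} (J : Op n) (r : ℝ) : aeval J (C r) = (r : ℂ) • (1 : Op n) := by
  rw [aeval_C, Algebra.algebraMap_eq_smul_one, real_smul_op]

theorem symC_two_eq (n : ℕ) :
    symC n 2 = (2 : ℂ) • angMomSq n - (3 * n / 2 : ℂ) • (1 : Op n) := by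
  have h := congrArg (fun A : Op n => (1 / 2 : ℂ) • A) (four_smul_angMomSq_eq n)
  simp only [smul_add, smul_smul] at h
  rw [eq_sub_iff_add_eq]
  convert h.symm using 2 <;> norm_num
  ring

theorem aeval_polyC (n p : ℕ) : aeval (angMomSq n) (polyC n p) = symC n (2 * p) := by
  suffices aeval (angMomSq n) (polyC n p) = symC n (2 * p) ∧
      aeval (angMomSq n) (polyC n (p + 1)) = symC n (2 * (p + 1)) from this.1
  induction p with
  | zero =>
    refine ⟨by simp [polyC, symC_zero], ?_⟩
    simp only [polyC, map_sub, map_mul, aeval_C_op, aeval_X, zero_add, mul_one, symC_two_eq,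
      smul_mul_assoc, one_mul]
    push_cast
    rfl
  | succ p ih =>
    refine ⟨ih.2, ?_⟩
    have h := symC_two_mul_symC n (2 * p)
    rw [symC_two_eq] at h
    rw [polyC]
    simp only [map_sub, map_mul, aeval_C_op, aeval_X, ih.1, ih.2, smul_mul_assoc, one_mul]
    have e : angMomSq n * symC n (2 * (p + 1)) = (1 / 2 : ℂ) • (((2 : ℂ) • angMomSq n -
        (3 * n / 2 : ℂ) • (1 : Op n)) * symC n (2 * p + 2) +
        (3 * n / 2 : ℂ) • symC n (2 * p + 2)) := by
      rw [sub_mul, smul_mul_assoc, smul_mul_assoc, one_mul, sub_add_cancel, smul_smul]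
      norm_num [mul_add]
    rw [sub_mul, smul_mul_assoc, smul_mul_assoc, one_mul, e, h,
      show 2 * (p + 1 + 1) = 2 * p + 4 by ring, show 2 * (p + 1) = 2 * p + 2 by ring]
    have hp : (p : ℂ) + 2 ≠ 0 := by exact_mod_cast (show p + 2 ≠ 0 by omega)
    push_cast
    match_scalars
    · field_simp
    · field_simp
      ring
    · field_simp
      ring

/-! ### Closed-form solution of the recursion -/

/-- The falling factorial `m (m - 1) ⋯ (m - k + 1)`. -/
noncomputable def falling (m : ℝ) (k : ℕ) : ℝ := ∏ i ∈ range k, (m - i)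

theorem falling_zero (m : ℝ) : falling m 0 = 1 := by simp [falling]

theorem falling_succ (m : ℝ) (k : ℕ) : falling m (k + 1) = falling m k * (m - k) := by
  rw [falling, Finset.prod_range_succ, falling]

theorem falling_succ_left (m : ℝ) (k : ℕ) : falling m (k + 1) = m * falling (m - 1) k := by
  rw [falling, Finset.prod_range_succ', falling, mul_comm]
  congr 1
  · simp
  · refine Finset.prod_congr rfl fun i _ => ?_
    push_cast
    ring

theorem falling_add (m : ℝ) (j k : ℕ) : falling m (j + k) = falling m j * falling (m - j) k := by
  induction k with
  | zero => simp [falling_zero]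
  | succ k ih =>
    rw [← add_assoc, falling_succ, ih, falling_succ]
    push_cast
    ring

theorem falling_natCast (m k : ℕ) : falling m k = (k.factorial : ℝ) * m.choose k := by
  rw [← Nat.cast_mul, ← Nat.descFactorial_eq_factorial_mul_choose]
  induction k with
  | zero => simp [falling_zero]
  | succ k ih =>
    rw [falling_succ, ih, Nat.descFactorial_succ, Nat.cast_mul, mul_comm]
    rcases le_or_gt k m with h | h
    · rw [Nat.cast_sub h]
    · simp [Nat.descFactorial_eq_zero_iff_lt.mpr h]

/-- The coefficient of `casimirProd n r x` in `polyC n p`. -/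
noncomputable def polyCoef (n p r : ℕ) : ℝ :=
  if r ≤ p then (-4) ^ r / (2 ^ p * r.factorial * (p - r).factorial) *
    falling ((n : ℝ) - 2 * r) (2 * (p - r)) else 0

/-- The product `∏ (n/2 - j - i) (n/2 + j + 1 - i)` over `i < r`, as a polynomial in
`x = j (j + 1)`. -/
noncomputable def casimirProd (n r : ℕ) (x : ℝ) : ℝ :=
  ∏ i ∈ range r, ((n : ℝ) / 2 * (n / 2 + 1) - x - i * (n + 1) + (i : ℝ) ^ 2)

theorem polyCoef_add (n k r : ℕ) : polyCoef n (k + r) r =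
    (-4) ^ r / (2 ^ (k + r) * r.factorial * k.factorial) *
      falling ((n : ℝ) - 2 * r) (2 * k) := by
  rw [polyCoef, if_pos (Nat.le_add_left r k), Nat.add_sub_cancel]

theorem polyCoef_of_lt {n p r : ℕ} (h : p < r) : polyCoef n p r = 0 := by
  rw [polyCoef, if_neg (by omega)]

/-- The recursion of `polyC` read off at `casimirProd n r`. Multiplication by `2x - 3n/2` sends
`casimirProd n r` to `-2` times its successor plus a multiple of itself, hence the term at `r - 1`.
-/
theorem polyCoef_rec (n p r : ℕ) (hr : r < p + 3) :
    -2 * (if r = 0 then 0 else polyCoef n (p + 1) (r - 1)) +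
      (((n : ℝ) - 2 * r) * (n - 2 * r - 1) / 2 - 3 * r) * polyCoef n (p + 1) r =
    ((p : ℝ) + 2) * polyCoef n (p + 2) r +
      ((n - 2 * p - 3) * (2 * p + 2)) * polyCoef n (p + 1) r +
      ((2 * p + 3) * ((n - 2 * p) * (n - 2 * p - 1) / 2)) * polyCoef n p r := by
  have hf : ∀ k : ℕ, (k.factorial : ℝ) ≠ 0 := fun k => Nat.cast_ne_zero.mpr k.factorial_ne_zero
  have hk2 : ∀ k : ℕ, (k : ℝ) + 1 ≠ 0 := fun k => by positivity
  have hk3 : ∀ k : ℕ, (k : ℝ) + 1 + 1 ≠ 0 := fun k => by positivity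
  -- The top two values of `r` are separate because `polyCoef n p r`, and for `r = p + 2` also
  -- `polyCoef n (p + 1) r`, is zero by definition there.
  obtain h | h | ⟨k, rfl⟩ : r = p + 2 ∨ r = p + 1 ∨ ∃ k, p = k + r := by
    rcases lt_trichotomy r (p + 1) with h | h | h
    · exact Or.inr (Or.inr ⟨p - r, by omega⟩)
    · exact Or.inr (Or.inl h)
    · exact Or.inl (by omega)
  · subst h
    rw [polyCoef_of_lt (show p + 1 < p + 2 by omega), polyCoef_of_lt (show p < p + 2 by omega),
      if_neg (by omega), show p + 2 - 1 = p + 1 by omega]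
    have e1 := polyCoef_add n 0 (p + 1)
    have e2 := polyCoef_add n 0 (p + 2)
    rw [zero_add] at e1 e2
    rw [e1, e2, Nat.factorial_succ (p + 1)]
    simp only [mul_zero, falling_zero, Nat.factorial_zero]
    have := hf (p + 1)
    have := hk3 p
    push_cast
    field_simp
    ring
  · subst h
    rw [polyCoef_of_lt (show p < p + 1 by omega), if_neg (by omega), Nat.add_sub_cancel]
    have e1 := polyCoef_add n 0 (p + 1)
    have e2 := polyCoef_add n 1 (p + 1)
    have e3 := polyCoef_add n 1 p
    rw [zero_add] at e1
    rw [show 1 + (p + 1) = p + 2 by ring] at e2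
    rw [add_comm 1 p] at e3
    rw [e1, e2, e3, Nat.factorial_succ p]
    simp only [falling_succ, falling_zero, mul_zero, mul_one, Nat.factorial_zero,
      Nat.factorial_one]
    have := hf p
    have := hk2 p
    push_cast
    field_simp
    ring
  · have e0 := polyCoef_add n k r
    have e1 := polyCoef_add n (k + 1) r
    have e2 := polyCoef_add n (k + 2) r
    rw [show k + 1 + r = k + r + 1 by ring] at e1
    rw [show k + 2 + r = k + r + 2 by ring] at e2
    rw [show 2 * (k + 1) = 2 * k + 1 + 1 by ring, falling_succ, falling_succ,
      Nat.factorial_succ] at e1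
    rw [show 2 * (k + 2) = 2 * k + 1 + 1 + 1 + 1 by ring, falling_succ, falling_succ,
      falling_succ, falling_succ, Nat.factorial_succ, Nat.factorial_succ] at e2
    have := hf k
    have := hk2 k
    have := hk3 k
    rw [e0, e1, e2]
    rcases r with _ | r
    · rw [if_pos rfl]
      have := hf 0
      push_cast
      field_simp
      ring
    · rw [if_neg (by omega), Nat.add_sub_cancel]
      have e3 := polyCoef_add n (k + 2) r
      rw [show k + 2 + r = k + (r + 1) + 1 by ring,
        show 2 * (k + 2) = 2 * k + 1 + 1 + 1 + 1 by ring, falling_succ_left, falling_succ_left,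
        falling_succ, falling_succ, Nat.factorial_succ, Nat.factorial_succ,
        show (n : ℝ) - 2 * r - 1 - 1 = n - 2 * ((r + 1 : ℕ) : ℝ) by push_cast; ring] at e3
      rw [e3, Nat.factorial_succ r]
      have := hf r
      have := hk2 r
      generalize falling ((n : ℝ) - 2 * ((r + 1 : ℕ) : ℝ)) (2 * k) = T
      push_cast
      field_simp
      ring

theorem eval_polyC_rec (n p : ℕ) (x : ℝ) :
    (2 * x - 3 * n / 2) * (polyC n (p + 1)).eval x = ((p : ℝ) + 2) * (polyC n (p + 2)).eval x +
      ((n - 2 * p - 3) * (2 * p + 2)) * (polyC n (p + 1)).eval x +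
      ((2 * p + 3) * ((n - 2 * p) * (n - 2 * p - 1) / 2)) * (polyC n p).eval x := by
  have hp : (p : ℝ) + 2 ≠ 0 := by positivity
  rw [polyC]
  simp only [eval_mul, eval_sub, eval_C, eval_X]
  field_simp
  ring

theorem sum_polyCoef_rec (n p : ℕ) (x : ℝ) :
    (2 * x - 3 * n / 2) * ∑ r ∈ range (p + 2), polyCoef n (p + 1) r * casimirProd n r x =
      ((p : ℝ) + 2) * ∑ r ∈ range (p + 3), polyCoef n (p + 2) r * casimirProd n r x +
      ((n - 2 * p - 3) * (2 * p + 2)) *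
        ∑ r ∈ range (p + 2), polyCoef n (p + 1) r * casimirProd n r x +
      ((2 * p + 3) * ((n - 2 * p) * (n - 2 * p - 1) / 2)) *
        ∑ r ∈ range (p + 1), polyCoef n p r * casimirProd n r x := by
  have e1 : ∑ r ∈ range (p + 2), polyCoef n (p + 1) r * casimirProd n r x =
      ∑ r ∈ range (p + 3), polyCoef n (p + 1) r * casimirProd n r x := by
    rw [Finset.sum_range_succ _ (p + 2), polyCoef_of_lt (show p + 1 < p + 2 by omega), zero_mul,
      add_zero]
  have e0 : ∑ r ∈ range (p + 1), polyCoef n p r * casimirProd n r x =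
      ∑ r ∈ range (p + 3), polyCoef n p r * casimirProd n r x := by
    rw [Finset.sum_range_succ _ (p + 2), Finset.sum_range_succ _ (p + 1),
      polyCoef_of_lt (show p < p + 2 by omega), polyCoef_of_lt (show p < p + 1 by omega)]
    simp
  have es : ∑ r ∈ range (p + 2), polyCoef n (p + 1) r * casimirProd n (r + 1) x =
      ∑ r ∈ range (p + 3), (if r = 0 then 0 else polyCoef n (p + 1) (r - 1)) *
        casimirProd n r x := by
    rw [Finset.sum_range_succ' _ (p + 2)]
    simp
  have key : (2 * x - 3 * n / 2) *
      ∑ r ∈ range (p + 2), polyCoef n (p + 1) r * casimirProd n r x =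
      -2 * ∑ r ∈ range (p + 2), polyCoef n (p + 1) r * casimirProd n (r + 1) x +
      ∑ r ∈ range (p + 2), (((n : ℝ) - 2 * r) * (n - 2 * r - 1) / 2 - 3 * r) *
        (polyCoef n (p + 1) r * casimirProd n r x) := by
    rw [Finset.mul_sum, Finset.mul_sum, ← Finset.sum_add_distrib]
    refine Finset.sum_congr rfl fun r _ => ?_
    rw [casimirProd, casimirProd, Finset.prod_range_succ]
    ring
  have e1' : ∑ r ∈ range (p + 2), (((n : ℝ) - 2 * r) * (n - 2 * r - 1) / 2 - 3 * r) *
        (polyCoef n (p + 1) r * casimirProd n r x) =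
      ∑ r ∈ range (p + 3), (((n : ℝ) - 2 * r) * (n - 2 * r - 1) / 2 - 3 * r) *
        (polyCoef n (p + 1) r * casimirProd n r x) := by
    rw [Finset.sum_range_succ _ (p + 2), polyCoef_of_lt (show p + 1 < p + 2 by omega)]
    simp
  rw [key, es, e1', e1, e0]
  simp only [Finset.mul_sum, ← Finset.sum_add_distrib]
  refine Finset.sum_congr rfl fun r hr => ?_
  linear_combination casimirProd n r x * polyCoef_rec n p r (Finset.mem_range.mp hr)

theorem eval_polyC (n p : ℕ) (x : ℝ) :
    (polyC n p).eval x = ∑ r ∈ range (p + 1), polyCoef n p r * casimirProd n r x := by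
  suffices (polyC n p).eval x = ∑ r ∈ range (p + 1), polyCoef n p r * casimirProd n r x ∧
      (polyC n (p + 1)).eval x = ∑ r ∈ range (p + 2), polyCoef n (p + 1) r * casimirProd n r x from
    this.1
  induction p with
  | zero =>
    constructor
    · simp [polyC, polyCoef, casimirProd, falling_zero]
    · rw [Finset.sum_range_succ, Finset.sum_range_succ, Finset.sum_range_zero]
      simp [polyC, polyCoef, casimirProd, falling_zero, falling_succ]
      ring
  | succ p ih =>
    refine ⟨ih.2, ?_⟩
    have hp : (p : ℝ) + 2 ≠ 0 := by positivity
    have h1 := eval_polyC_rec n p x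
    have h2 := sum_polyCoef_rec n p x
    rw [← ih.1, ← ih.2] at h2
    refine mul_left_cancel₀ hp ?_
    linear_combination h2 - h1

/-! ### Values at `j (j + 1)`: vanishing, integrality and the multiplicity formula -/

/-- The eigenvalue `j (j + 1)` of `J²`, `j = t / 2`. -/
noncomputable def casimir (t : ℕ) : ℝ := (t : ℝ) / 2 * ((t : ℝ) / 2 + 1)

theorem casimirProd_casimir (k t r : ℕ) :
    casimirProd (t + 2 * k) r (casimir t) = falling k r * falling ((t + k + 1 : ℕ) : ℝ) r := by
  rw [casimirProd, falling, falling, ← Finset.prod_mul_distrib]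
  refine Finset.prod_congr rfl fun i _ => ?_
  rw [casimir]
  push_cast
  ring

theorem mem_twiceSpins {n t : ℕ} : t ∈ twiceSpins n ↔ ∃ k, n = t + 2 * k := by
  simp only [twiceSpins, Finset.mem_filter, Finset.mem_range]
  constructor
  · rintro ⟨h1, h2⟩
    exact ⟨(n - t) / 2, by omega⟩
  · rintro ⟨k, rfl⟩
    omega

theorem eval_polyC_casimir_of_gt {n p t : ℕ} (ht : t ∈ twiceSpins n) (hp : n < 2 * p) :
    (polyC n p).eval (casimir t) = 0 := by
  obtain ⟨k, rfl⟩ := mem_twiceSpins.mp ht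
  rw [eval_polyC]
  refine Finset.sum_eq_zero fun r hr => ?_
  have hr := Finset.mem_range.mp hr
  -- Each summand vanishes. If `2r ≤ n`, the falling factorial of the natural number `n - 2r` has
  -- more than `n - 2r` factors. Otherwise `r > k` and `falling k r = 0`.
  by_cases h : 2 * r ≤ t + 2 * k
  · have : falling (((t + 2 * k : ℕ) : ℝ) - 2 * r) (2 * (p - r)) = 0 := by
      rw [show ((t + 2 * k : ℕ) : ℝ) - 2 * r = ((t + 2 * k - 2 * r : ℕ) : ℝ) by
        rw [Nat.cast_sub h]; push_cast; ring, falling_natCast, Nat.choose_eq_zero_of_lt (by omega)]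
      simp
    rw [polyCoef, this]
    simp
  · rw [casimirProd_casimir, falling_natCast k, Nat.choose_eq_zero_of_lt (by omega)]
    simp

theorem exists_factorial_two_mul (k : ℕ) : ∃ d : ℕ, (2 * k).factorial = 2 ^ k * k.factorial * d := by
  induction k with
  | zero => exact ⟨1, by simp⟩
  | succ k ih =>
    obtain ⟨d, hd⟩ := ih
    refine ⟨(2 * k + 1) * d, ?_⟩
    rw [show 2 * (k + 1) = 2 * k + 1 + 1 by ring, Nat.factorial_succ, Nat.factorial_succ, hd,
      Nat.factorial_succ]
    ring

theorem eval_polyC_casimir_int {n p t : ℕ} (ht : t ∈ twiceSpins n) (hp : 2 * p ≤ n) :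
    ∃ z : ℤ, (polyC n p).eval (casimir t) = z := by
  obtain ⟨k, rfl⟩ := mem_twiceSpins.mp ht
  have h : ∀ r ∈ range (p + 1), ∃ z : ℤ,
      polyCoef (t + 2 * k) p r * casimirProd (t + 2 * k) r (casimir t) = z := by
    intro r hr
    have hr := Finset.mem_range.mp hr
    obtain ⟨j, rfl⟩ : ∃ j, p = j + r := ⟨p - r, by omega⟩
    obtain ⟨d, hd⟩ := exists_factorial_two_mul j
    -- The three falling factorials contribute `(2j)! r! r!` times binomials. With `(2j)! = 2 ^ j j!
    -- d` this absorbs the denominator `2 ^ (j + r) r! j!`.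
    refine ⟨(-2) ^ r * r.factorial * d * (t + 2 * k - 2 * r).choose (2 * j) * k.choose r *
      (t + k + 1).choose r, ?_⟩
    rw [polyCoef_add, casimirProd_casimir, falling_natCast, falling_natCast,
      show ((t + 2 * k : ℕ) : ℝ) - 2 * r = ((t + 2 * k - 2 * r : ℕ) : ℝ) by
        rw [Nat.cast_sub (by omega)]; push_cast; ring, falling_natCast, hd,
      show (-4 : ℝ) ^ r = (-2) ^ r * 2 ^ r by rw [← mul_pow]; norm_num]
    have := Nat.cast_ne_zero (R := ℝ).mpr r.factorial_ne_zero
    have := Nat.cast_ne_zero (R := ℝ).mpr j.factorial_ne_zero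
    push_cast
    field_simp
    ring
  choose! z hz using h
  refine ⟨∑ r ∈ range (p + 1), z r, ?_⟩
  rw [eval_polyC, Int.cast_sum]
  exact Finset.sum_congr rfl hz

theorem mult_add (t k : ℕ) : mult (t + 2 * k) t =
    ((t + 2 * k).factorial : ℝ) * (t + 1) / (k.factorial * (t + k + 1).factorial) := by
  rw [mult, if_pos (by omega), show (t + 2 * k - t) / 2 = k by omega,
    show t + 2 * k = k + (t + k) by ring, Nat.cast_add_choose, Nat.factorial_succ]
  have := Nat.cast_ne_zero (R := ℝ).mpr k.factorial_ne_zero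
  have := Nat.cast_ne_zero (R := ℝ).mpr (t + k).factorial_ne_zero
  have : (t : ℝ) + k + 1 ≠ 0 := by positivity
  push_cast
  rw [show ((k : ℝ) + (t + k)) / 2 + t / 2 + 1 = t + k + 1 by ring]
  field_simp

theorem mult_of_lt {a t : ℕ} (h : a < t) : mult a t = 0 := by
  rw [mult, if_neg (by omega)]

theorem mult_pos {n t : ℕ} (ht : t ∈ twiceSpins n) : 0 < mult n t := by
  obtain ⟨k, rfl⟩ := mem_twiceSpins.mp ht
  rw [mult_add]
  positivity

theorem mult_add_two {m t : ℕ} (ht : t ∈ twiceSpins (m + 2)) :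
    ((m : ℝ) + 2) * (m + 1) * mult m t =
      mult (m + 2) t * ((m + 2) / 2 * ((m + 2) / 2 + 1) - casimir t) := by
  obtain ⟨k, hk⟩ := mem_twiceSpins.mp ht
  rcases k with _ | k
  · rw [mult_of_lt (by omega), casimir, show (t : ℝ) = m + 2 by
      exact_mod_cast (show t = m + 2 by omega)]
    ring
  · obtain rfl : m = t + 2 * k := by omega
    rw [mult_add, show t + 2 * k + 2 = t + 2 * (k + 1) by ring, mult_add,
      show t + 2 * (k + 1) = t + 2 * k + 1 + 1 by ring,
      show t + (k + 1) + 1 = t + k + 1 + 1 by ring, Nat.factorial_succ (t + 2 * k + 1),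
      Nat.factorial_succ (t + 2 * k), Nat.factorial_succ k, Nat.factorial_succ (t + k + 1), casimir]
    have := Nat.cast_ne_zero (R := ℝ).mpr k.factorial_ne_zero
    have := Nat.cast_ne_zero (R := ℝ).mpr (t + k + 1).factorial_ne_zero
    have : (t : ℝ) + k + 1 + 1 ≠ 0 := by positivity
    push_cast
    field_simp
    ring

/-- Iterates `mult_add_two`, each removal of two qubits contributing one factor of `casimirProd`.
Once `t` exceeds the number of remaining qubits, both sides are zero. -/
theorem falling_mul_mult {n t : ℕ} (ht : t ∈ twiceSpins n) (r : ℕ) (hr : 2 * r ≤ n) :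
    falling n (2 * r) * mult (n - 2 * r) t = mult n t * casimirProd n r (casimir t) := by
  induction r with
  | zero => simp [falling_zero, casimirProd]
  | succ r ih =>
    have ih := ih (by omega)
    obtain ⟨m, rfl⟩ : ∃ m, n = m + 2 * (r + 1) := ⟨n - 2 * (r + 1), by omega⟩
    rw [show m + 2 * (r + 1) - 2 * r = m + 2 by omega] at ih
    rw [Nat.add_sub_cancel, casimirProd, Finset.prod_range_succ, ← casimirProd, ← mul_assoc, ← ih,
      show 2 * (r + 1) = 2 * r + 1 + 1 by ring, falling_succ, falling_succ]
    by_cases h : t ∈ twiceSpins (m + 2)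
    · have h2 := mult_add_two h
      push_cast
      linear_combination falling (m + (2 * r + 1 + 1) : ℝ) (2 * r) * h2
    · have hlt : m + 2 < t := by
        obtain ⟨k, hk⟩ := mem_twiceSpins.mp ht
        by_contra hc
        exact h (mem_twiceSpins.mpr ⟨k - r, by omega⟩)
      rw [mult_of_lt hlt, mult_of_lt (by omega)]
      ring

theorem eval_polyC_casimir {n p t : ℕ} (ht : t ∈ twiceSpins n) (hp : 2 * p ≤ n) :
    (polyC n p).eval (casimir t) =
      ((2 * p).factorial : ℝ) / (2 ^ p * (p.factorial : ℝ)) * (n.choose (2 * p) : ℝ) *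
        ∑ r ∈ range (p + 1), (-4 : ℝ) ^ r * (p.choose r : ℝ) * (mult (n - 2 * r) t / mult n t) := by
  rw [eval_polyC, Finset.mul_sum]
  refine Finset.sum_congr rfl fun r hr => ?_
  have hr := Finset.mem_range.mp hr
  obtain ⟨k, rfl⟩ : ∃ k, p = r + k := ⟨p - r, by omega⟩
  have h1 := falling_mul_mult ht r (by omega)
  have h2 : ((2 * (r + k)).factorial : ℝ) * (n.choose (2 * (r + k)) : ℝ) =
      falling n (2 * r) * falling (n - 2 * r) (2 * k) := by
    rw [← falling_natCast, mul_add, falling_add]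
    push_cast
    rfl
  have hm := (mult_pos ht).ne'
  have h3 : casimirProd n r (casimir t) = falling n (2 * r) * mult (n - 2 * r) t / mult n t := by
    rw [h1, mul_div_cancel_left₀ _ hm]
  rw [add_comm r k, polyCoef_add, h3, add_comm k r, Nat.cast_add_choose]
  have := Nat.cast_ne_zero (R := ℝ).mpr k.factorial_ne_zero
  have := Nat.cast_ne_zero (R := ℝ).mpr r.factorial_ne_zero
  have := Nat.cast_ne_zero (R := ℝ).mpr (r + k).factorial_ne_zero
  have h4 : ((2 * (r + k)).factorial : ℝ) / (2 ^ (r + k) * ((r + k).factorial : ℝ)) *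
      (n.choose (2 * (r + k)) : ℝ) = falling n (2 * r) * falling (n - 2 * r) (2 * k) /
        (2 ^ (r + k) * ((r + k).factorial : ℝ)) := by
    rw [← h2]
    ring
  rw [h4]
  field_simp

/-! ### Branching rule and dimension count -/

/-- `mult`, extended by zero to `t` of the wrong parity. -/
noncomputable def multExt (a t : ℕ) : ℝ := if t % 2 = a % 2 then mult a t else 0

theorem multExt_of_lt {a t : ℕ} (h : a < t) : multExt a t = 0 := by
  rw [multExt, mult_of_lt h, ite_self]

theorem multExt_succ_zero (a : ℕ) : multExt (a + 1) 0 = multExt a 1 := by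
  simp only [multExt]
  by_cases h : a % 2 = 1
  · obtain ⟨k, rfl⟩ : ∃ k, a = 1 + 2 * k := ⟨a / 2, by omega⟩
    rw [if_pos (by omega), if_pos (by omega), mult_add,
      show 1 + 2 * k + 1 = 0 + 2 * (k + 1) by ring, mult_add,
      show 0 + 2 * (k + 1) = 1 + 2 * k + 1 by ring, show 0 + (k + 1) + 1 = 1 + k + 1 by ring,
      Nat.factorial_succ (1 + 2 * k), Nat.factorial_succ k]
    have := Nat.cast_ne_zero (R := ℝ).mpr k.factorial_ne_zero
    have := Nat.cast_ne_zero (R := ℝ).mpr (1 + k + 1).factorial_ne_zero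
    push_cast
    field_simp
    ring
  · rw [if_neg (by omega), if_neg (by omega)]

/-- The branching rule for adding a qubit: spin `(t + 1) / 2` arises from spins `t / 2` and `t / 2 +
1`. -/
theorem multExt_succ_succ (a t : ℕ) :
    multExt (a + 1) (t + 1) = multExt a t + multExt a (t + 2) := by
  rcases lt_or_ge a t with hat | hat
  · rw [multExt_of_lt (by omega), multExt_of_lt hat, multExt_of_lt (by omega), add_zero]
  simp only [multExt]
  by_cases h : t % 2 = a % 2
  · obtain ⟨k, rfl⟩ : ∃ k, a = t + 2 * k := ⟨(a - t) / 2, by omega⟩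
    rw [if_pos (by omega), if_pos (by omega), if_pos (by omega), mult_add,
      show t + 2 * k + 1 = t + 1 + 2 * k by ring, mult_add]
    have := Nat.cast_ne_zero (R := ℝ).mpr k.factorial_ne_zero
    have := Nat.cast_ne_zero (R := ℝ).mpr (t + k + 1).factorial_ne_zero
    have : (t : ℝ) + k + 1 + 1 ≠ 0 := by positivity
    rcases k with _ | k
    · rw [mult_of_lt (by omega)]
      simp only [mul_zero, add_zero, Nat.factorial_zero, Nat.factorial_succ] at *
      have := Nat.cast_ne_zero (R := ℝ).mpr t.factorial_ne_zero
      push_cast at *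
      field_simp
    · rw [show t + 2 * (k + 1) = t + 2 + 2 * k by ring, mult_add,
        show t + 1 + 2 * (k + 1) = t + 2 + 2 * k + 1 by ring,
        show t + 1 + (k + 1) + 1 = t + (k + 1) + 1 + 1 by ring,
        show t + 2 + k + 1 = t + (k + 1) + 1 + 1 by ring,
        Nat.factorial_succ (t + 2 + 2 * k), Nat.factorial_succ (t + (k + 1) + 1),
        Nat.factorial_succ k]
      have := Nat.cast_ne_zero (R := ℝ).mpr k.factorial_ne_zero
      push_cast at *
      field_simp
      ring
  · rw [if_neg (by omega), if_neg (by omega), if_neg (by omega), add_zero]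

theorem sum_range_multExt (a N : ℕ) (hN : a < N) :
    ∑ t ∈ range N, ((t : ℝ) + 1) * multExt a t = 2 ^ a := by
  induction a generalizing N with
  | zero =>
    rw [Finset.sum_eq_single 0]
    · simp [multExt, mult]
    · intro t _ ht
      rw [multExt_of_lt (by omega), mul_zero]
    · intro h
      exact absurd (Finset.mem_range.mpr hN) h
  | succ a ih =>
    obtain ⟨M, rfl⟩ : ∃ M, N = M + 1 := ⟨N - 1, by omega⟩
    -- The top two terms vanish since `a < M`. Splitting off the bottom two terms instead turns this
    -- into the index shift by two that the branching rule needs.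
    have h1 : ∑ t ∈ range (M + 2), (t : ℝ) * multExt a t = ∑ t ∈ range M, (t : ℝ) * multExt a t := by
      rw [Finset.sum_range_succ, Finset.sum_range_succ, multExt_of_lt (show a < M by omega),
        multExt_of_lt (show a < M + 1 by omega)]
      simp
    rw [Finset.sum_range_succ', Finset.sum_range_succ'] at h1
    rw [Finset.sum_range_succ', multExt_succ_zero, pow_succ, ← ih M (by omega), Finset.sum_mul]
    simp only [multExt_succ_succ]
    have h2 : ∑ t ∈ range M, (((t + 1 : ℕ) : ℝ) + 1) * (multExt a t + multExt a (t + 2)) =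
        ∑ t ∈ range M, ((t : ℝ) + 2) * multExt a t +
          ∑ t ∈ range M, ((t + 1 + 1 : ℕ) : ℝ) * multExt a (t + 1 + 1) := by
      rw [← Finset.sum_add_distrib]
      refine Finset.sum_congr rfl fun t _ => ?_
      push_cast
      ring
    have h3 : ∑ t ∈ range M, ((t : ℝ) + 1) * multExt a t * 2 =
        ∑ t ∈ range M, ((t : ℝ) + 2) * multExt a t + ∑ t ∈ range M, (t : ℝ) * multExt a t := by
      rw [← Finset.sum_add_distrib]
      refine Finset.sum_congr rfl fun t _ => ?_
      ring
    rw [h2, h3, ← h1]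
    push_cast
    ring

theorem sum_twiceSpins_mult (n r : ℕ) (hr : 2 * r ≤ n) :
    ∑ t ∈ twiceSpins n, ((t : ℝ) + 1) * mult (n - 2 * r) t = 2 ^ (n - 2 * r) := by
  rw [← sum_range_multExt (n - 2 * r) (n + 1) (by omega), twiceSpins, Finset.sum_filter]
  refine Finset.sum_congr rfl fun t _ => ?_
  rw [multExt, show (n - 2 * r) % 2 = n % 2 by omega]
  split_ifs <;> simp

/-- The weights cancel `m(n, j)` in the denominators. The dimension count `2 ^ (n - 2r)` then turns
`(-4) ^ r` into `2 ^ n (-1) ^ r`, leaving the binomial expansion of `(1 - 1) ^ p`. -/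
theorem sum_mult_mul_eval_polyC (n p : ℕ) :
    ∑ t ∈ twiceSpins n, ((t : ℝ) + 1) * mult n t * (polyC n p).eval (casimir t) =
      if p = 0 then 2 ^ n else 0 := by
  rcases lt_or_ge n (2 * p) with hp | hp
  · rw [if_neg (by omega)]
    refine Finset.sum_eq_zero fun t ht => ?_
    rw [eval_polyC_casimir_of_gt ht hp, mul_zero]
  have h1 : ∀ t ∈ twiceSpins n, ((t : ℝ) + 1) * mult n t * (polyC n p).eval (casimir t) =
      ((2 * p).factorial : ℝ) / (2 ^ p * (p.factorial : ℝ)) * (n.choose (2 * p) : ℝ) *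
        ∑ r ∈ range (p + 1), (-4 : ℝ) ^ r * (p.choose r : ℝ) *
          (((t : ℝ) + 1) * mult (n - 2 * r) t) := by
    intro t ht
    have hm := (mult_pos ht).ne'
    rw [eval_polyC_casimir ht hp, mul_left_comm, Finset.mul_sum]
    congr 1
    refine Finset.sum_congr rfl fun r _ => ?_
    field_simp
  rw [Finset.sum_congr rfl h1, ← Finset.mul_sum, Finset.sum_comm]
  have h2 : ∑ r ∈ range (p + 1), ∑ t ∈ twiceSpins n, (-4 : ℝ) ^ r * (p.choose r : ℝ) *
      (((t : ℝ) + 1) * mult (n - 2 * r) t) =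
      2 ^ n * ∑ r ∈ range (p + 1), (-1 : ℝ) ^ r * 1 ^ (p - r) * (p.choose r : ℝ) := by
    rw [Finset.mul_sum]
    refine Finset.sum_congr rfl fun r hr => ?_
    have hr := Finset.mem_range.mp hr
    rw [← Finset.mul_sum, sum_twiceSpins_mult n r (by omega)]
    obtain ⟨m, rfl⟩ : ∃ m, n = m + 2 * r := ⟨n - 2 * r, by omega⟩
    rw [Nat.add_sub_cancel, pow_add, pow_mul,
      show (-4 : ℝ) ^ r = (-1) ^ r * (2 ^ 2) ^ r by rw [← mul_pow]; norm_num]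
    ring
  rw [h2, ← add_pow]
  rcases p with _ | p
  · simp
  · simp

/-! ### Hermiticity and the spectral decomposition of `J²` -/

theorem gaussMoment_star (k : ℕ) : star (gaussMoment k) = gaussMoment k := by
  induction k using Nat.twoStepInduction with
  | zero => simp [gaussMoment]
  | one => simp [gaussMoment]
  | more k ih _ => simp [gaussMoment, -RCLike.star_def, ih]

theorem coef_star (l a b c : ℕ) : star (coef l a b c) = coef l a b c := by
  rw [coef]
  split_ifs
  · rw [star_mul', star_mul', gaussMoment_star, gaussMoment_star, gaussMoment_star]
  · exact star_zero ℂ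

theorem symC_isHermitian (n l : ℕ) : (symC n l)ᴴ = symC n l := by
  simp only [symC, symOp, conjTranspose_sum, conjTranspose_smul, coef_star,
    pauliString_isHermitian]

theorem angMomSq_isHermitian (n : ℕ) : (angMomSq n)ᴴ = angMomSq n := by
  have h : angMomSq n = (1 / 4 : ℂ) • ((2 : ℂ) • symC n 2 + (3 * n : ℂ) • (1 : Op n)) := by
    rw [← four_smul_angMomSq_eq, smul_smul]
    norm_num
  rw [h]
  simp only [conjTranspose_smul, conjTranspose_add, symC_isHermitian, conjTranspose_one]
  norm_num

theorem aeval_isHermitian {n : ℕ} {J : Op n} (hJ : Jᴴ = J) (f : ℝ[X]) :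
    (aeval J f)ᴴ = aeval J f := by
  induction f using Polynomial.induction_on' with
  | add p q hp hq => rw [map_add, conjTranspose_add, hp, hq]
  | monomial k a =>
    rw [aeval_monomial, Algebra.algebraMap_eq_smul_one, smul_mul_assoc, one_mul, real_smul_op,
      conjTranspose_smul, conjTranspose_pow, hJ]
    simp

theorem casimir_strictMono : StrictMono casimir := by
  refine strictMono_nat_of_lt_succ fun t => ?_
  simp only [casimir]
  push_cast
  have : (0 : ℝ) ≤ t := t.cast_nonneg
  nlinarith

theorem card_twiceSpins (n : ℕ) : #(twiceSpins n) = n / 2 + 1 := by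
  have h : twiceSpins n = (range (n / 2 + 1)).image fun k => n - 2 * k := by
    ext t
    rw [mem_twiceSpins, Finset.mem_image]
    constructor
    · rintro ⟨k, rfl⟩
      exact ⟨k, Finset.mem_range.mpr (by omega), by omega⟩
    · rintro ⟨k, hk, rfl⟩
      have := Finset.mem_range.mp hk
      exact ⟨k, by omega⟩
  rw [h, Finset.card_image_of_injOn, Finset.card_range]
  intro a ha b hb hab
  have := Finset.mem_range.mp ha
  have := Finset.mem_range.mp hb
  simp only at hab
  omega

theorem eq_zero_of_eval_casimir {n : ℕ} {f : ℝ[X]} (hd : f.degree < (n / 2 + 1 : ℕ))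
    (hf : ∀ t ∈ twiceSpins n, f.eval (casimir t) = 0) : f = 0 :=
  Polynomial.eq_zero_of_degree_lt_of_eval_index_eq_zero _
    (casimir_strictMono.injective.injOn) (by rwa [card_twiceSpins]) hf

theorem cnt_le {n : ℕ} (w : Fin n → Fin 4) : cnt w 1 + cnt w 2 + cnt w 3 ≤ n := by
  have := cnt_sum w
  omega

theorem symC_of_gt {n l : ℕ} (h : n < l) : symC n l = 0 := by
  rw [symC, symOp]
  refine Finset.sum_eq_zero fun w _ => ?_
  rw [coef, if_neg (by have := cnt_le w; omega), zero_smul]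

theorem polyC_ne_zero (n p : ℕ) : polyC n p ≠ 0 := fun h => by
  have := (polyC_degree_aux n p).1.2
  simp [h] at this

theorem polyC_degree (n p : ℕ) : (polyC n p).degree = p := by
  rw [degree_eq_natDegree (polyC_ne_zero n p), polyC_natDegree]

/-- `polyC n (n / 2 + 1)` has all candidates as roots and annihilates `J²`. Modulo it, `f` has
degree at most `n / 2` but `n / 2 + 1` distinct roots, so it divides `f`. -/
theorem aeval_eq_zero {n : ℕ} {f : ℝ[X]} (hf : ∀ t ∈ twiceSpins n, f.eval (casimir t) = 0) :
    aeval (angMomSq n) f = 0 := by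
  have h0 : ∀ t ∈ twiceSpins n, (polyC n (n / 2 + 1)).eval (casimir t) = 0 := fun t ht =>
    eval_polyC_casimir_of_gt ht (by omega)
  have h1 := EuclideanDomain.div_add_mod f (polyC n (n / 2 + 1))
  have h2 : f % polyC n (n / 2 + 1) = 0 := by
    refine eq_zero_of_eval_casimir (n := n) ?_ fun t ht => ?_
    · rw [← polyC_degree n (n / 2 + 1)]
      exact degree_mod_lt _ (polyC_ne_zero _ _)
    · have h3 := congrArg (eval (casimir t)) h1
      rwa [eval_add, eval_mul, h0 t ht, hf t ht, zero_mul, zero_add] at h3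
  rw [← h1, h2, add_zero, map_mul, aeval_polyC, symC_of_gt (by omega), zero_mul]

/-- The spectral projection of `J²` as a polynomial in `J²`. -/
noncomputable def spectralProj (n t : ℕ) : Op n :=
  aeval (angMomSq n) (Lagrange.basis (twiceSpins n) casimir t)

theorem aeval_mul_spectralProj (n t : ℕ) (f : ℝ[X]) :
    aeval (angMomSq n) f * spectralProj n t =
      ((f.eval (casimir t) : ℝ) : ℂ) • spectralProj n t := by
  have h : aeval (angMomSq n)
      ((f - C (f.eval (casimir t))) * Lagrange.basis (twiceSpins n) casimir t) = 0 := by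
    refine aeval_eq_zero fun s hs => ?_
    by_cases hst : t = s
    · subst hst; simp
    · rw [eval_mul, Lagrange.eval_basis_of_ne hst hs, mul_zero]
  rwa [map_mul, map_sub, aeval_C_op, sub_mul, smul_mul_assoc, one_mul, sub_eq_zero] at h

theorem aeval_eq_sum {n : ℕ} (f : ℝ[X]) :
    aeval (angMomSq n) f =
      ∑ t ∈ twiceSpins n, ((f.eval (casimir t) : ℝ) : ℂ) • spectralProj n t := by
  have hne : (twiceSpins n).Nonempty := ⟨n, mem_twiceSpins.mpr ⟨0, rfl⟩⟩
  have h := congrArg (aeval (angMomSq n))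
    (Lagrange.sum_basis (casimir_strictMono.injective.injOn (s := (twiceSpins n : Set ℕ))) hne)
  rw [map_one, map_sum] at h
  rw [← mul_one (aeval (angMomSq n) f), ← h, Finset.mul_sum]
  exact Finset.sum_congr rfl fun t _ => aeval_mul_spectralProj n t f

theorem proj_eq_spectralProj {n t : ℕ} (ht : t ∈ twiceSpins n) :
    proj n t = spectralProj n t := by
  set φ := Matrix.toEuclideanCLM (n := Fin n → Fin 2) (𝕜 := ℂ) with hφ
  have hmem : ∀ u, u ∈ sector n t ↔ φ (angMomSq n) u = ((casimir t : ℝ) : ℂ) • u := by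
    intro u
    rw [sector, Module.End.mem_eigenspace_iff, casimir]
    push_cast
    rfl
  have hfix : ∀ u ∈ sector n t, φ (spectralProj n t) u = u := by
    intro u hu
    -- The Lagrange polynomial takes the value one at its own node, so it acts as the identity on
    -- the eigenspace.
    obtain ⟨g, hg⟩ : (X - C (casimir t)) ∣ (Lagrange.basis (twiceSpins n) casimir t - 1) := by
      rw [dvd_iff_isRoot, IsRoot.def, eval_sub, eval_one,
        Lagrange.eval_basis_self casimir_strictMono.injective.injOn ht, sub_self]
    have h1 : spectralProj n t = aeval (angMomSq n) g *
        (angMomSq n - ((casimir t : ℝ) : ℂ) • 1) + 1 := by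
      have h := congrArg (aeval (angMomSq n)) hg
      rw [mul_comm, map_sub, map_one, map_mul, map_sub, aeval_X, aeval_C_op, sub_eq_iff_eq_add] at h
      exact h
    rw [h1, map_add, map_mul, map_sub, map_smul, map_one]
    simp [(hmem u).mp hu]
  have hself : star (φ (spectralProj n t)) = φ (spectralProj n t) := by
    rw [← map_star, star_eq_conjTranspose, spectralProj,
      aeval_isHermitian (angMomSq_isHermitian n)]
  rw [proj, ← hφ, StarAlgEquiv.symm_apply_eq]
  ext1 v
  refine Submodule.eq_starProjection_of_mem_of_inner_eq_zero ?_ ?_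
  · rw [hmem, ← mul_apply_eq_comp, ← map_mul]
    have h := aeval_mul_spectralProj n t X
    rw [aeval_X, eval_X] at h
    rw [h, map_smul]
    rfl
  · intro w hw
    rw [inner_sub_left, ← ContinuousLinearMap.adjoint_inner_right,
      ← ContinuousLinearMap.star_eq_adjoint, hself, hfix w hw, sub_self]

/-! ### Traces, orthogonality and the basis property -/

theorem trace_pauliString {n : ℕ} {w : Fin n → Fin 4} (hw : w ≠ fun _ => 0) :
    (pauliString w).trace = 0 := by
  rw [← mul_one (pauliString w), ← pauliString_zero, trace_pauliString_mul hw]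

theorem trace_symC (n l : ℕ) : (symC n l).trace = if l = 0 then 2 ^ n else 0 := by
  split_ifs with h
  · subst h
    rw [symC_zero, trace_one]
    simp
  · rw [symC, symOp, trace_sum]
    refine Finset.sum_eq_zero fun w _ => ?_
    rw [trace_smul]
    by_cases hw : w = fun _ => 0
    · subst hw
      simp [coef, cnt, Ne.symm h]
    · rw [trace_pauliString hw, smul_zero]

theorem trace_symC_mul_symC (n : ℕ) {l l' : ℕ} (h : l ≠ l') :
    (symC n l * symC n l').trace = 0 := by
  rw [symC, symC, symOp, symOp, Finset.sum_mul, trace_sum]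
  refine Finset.sum_eq_zero fun w _ => ?_
  rw [Finset.mul_sum, trace_sum]
  refine Finset.sum_eq_zero fun w' _ => ?_
  rw [Matrix.smul_mul, Matrix.mul_smul, trace_smul, trace_smul]
  by_cases hw : w = w'
  · subst hw
    by_cases h1 : cnt w 1 + cnt w 2 + cnt w 3 = l
    · rw [coef.eq_def l', if_neg (by omega)]
      simp
    · rw [coef, if_neg h1]
      simp
  · rw [trace_pauliString_mul hw]
    simp

/-- Both sides are linear in `f` and agree on each `polyC n p`. These have degrees `0, 1, 2, …`,
hence span all polynomials. -/
theorem trace_aeval (n : ℕ) (f : ℝ[X]) : (aeval (angMomSq n) f).trace =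
    ((∑ t ∈ twiceSpins n, ((t : ℝ) + 1) * mult n t * f.eval (casimir t) : ℝ) : ℂ) := by
  let S : Polynomial.Sequence ℝ := ⟨polyC n, polyC_degree n⟩
  have hS : f ∈ Submodule.span ℝ (Set.range (polyC n)) := by
    have := S.span fun i => isUnit_iff_ne_zero.mpr (leadingCoeff_ne_zero.mpr (S.ne_zero i))
    exact this ▸ Submodule.mem_top
  induction hS using Submodule.span_induction with
  | mem f hf =>
    obtain ⟨p, rfl⟩ := hf
    rw [sum_mult_mul_eval_polyC, aeval_polyC, trace_symC]
    split_ifs <;> simp <;> omega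
  | zero => simp
  | add f g _ _ hf hg =>
    rw [map_add, trace_add, hf, hg, ← Complex.ofReal_add, ← Finset.sum_add_distrib]
    simp only [eval_add, mul_add]
  | smul a f _ hf =>
    rw [map_smul, real_smul_op, trace_smul, hf, smul_eq_mul, ← Complex.ofReal_mul, Finset.mul_sum]
    simp only [eval_smul, smul_eq_mul, mul_left_comm]

theorem trace_proj {n t : ℕ} (ht : t ∈ twiceSpins n) :
    (proj n t).trace = ((((t : ℝ) + 1) * mult n t : ℝ) : ℂ) := by
  rw [proj_eq_spectralProj ht, spectralProj, trace_aeval]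
  congr 1
  rw [Finset.sum_eq_single_of_mem t ht,
    Lagrange.eval_basis_self casimir_strictMono.injective.injOn ht, mul_one]
  intro s hs hst
  rw [Lagrange.eval_basis_of_ne hst.symm hs, mul_zero]

theorem trace_proj_ne_zero {n t : ℕ} (ht : t ∈ twiceSpins n) : (proj n t).trace ≠ 0 := by
  rw [trace_proj ht, Complex.ofReal_ne_zero]
  have := mult_pos ht
  positivity

theorem cOp_eq_aeval (n p : ℕ) : cOp n (2 * p) = aeval (angMomSq n) (polyC n p) := by
  rw [cOp_eq_symC, aeval_polyC]

theorem cEig_eq {n t : ℕ} (ht : t ∈ twiceSpins n) (p : ℕ) :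
    cEig n (2 * p) t = (((polyC n p).eval (casimir t) : ℝ) : ℂ) := by
  rw [cEig, cOp_eq_aeval, div_eq_iff (trace_proj_ne_zero ht), proj_eq_spectralProj ht,
    aeval_mul_spectralProj, trace_smul, smul_eq_mul]

theorem cOp_mul_proj {n t : ℕ} (ht : t ∈ twiceSpins n) (p : ℕ) :
    cOp n (2 * p) * proj n t = cEig n (2 * p) t • proj n t := by
  rw [cEig_eq ht, cOp_eq_aeval, proj_eq_spectralProj ht, aeval_mul_spectralProj]

theorem cOp_eq_sum (n p : ℕ) :
    cOp n (2 * p) = ∑ t ∈ twiceSpins n, cEig n (2 * p) t • proj n t := by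
  rw [cOp_eq_aeval, aeval_eq_sum]
  refine Finset.sum_congr rfl fun t ht => ?_
  rw [cEig_eq ht, proj_eq_spectralProj ht]

/-- Otherwise all eigenvalues vanish, giving a nonzero polynomial of degree `p ≤ n / 2` with `n / 2
+ 1` roots. -/
theorem cOp_ne_zero {n p : ℕ} (hp : 2 * p ≤ n) : cOp n (2 * p) ≠ 0 := by
  intro h
  refine polyC_ne_zero n p (eq_zero_of_eval_casimir (n := n) ?_ fun t ht => ?_)
  · rw [polyC_degree, Nat.cast_lt]
    omega
  · rw [← Complex.ofReal_eq_zero, ← cEig_eq ht, cEig, h]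
    simp

open scoped ComplexOrder in
theorem trace_cOp_sq_ne_zero {n p : ℕ} (hp : 2 * p ≤ n) :
    (cOp n (2 * p) * cOp n (2 * p)).trace ≠ 0 := by
  intro h
  refine cOp_ne_zero hp (trace_conjTranspose_mul_self_eq_zero_iff.mp ?_)
  rwa [cOp_eq_symC, symC_isHermitian, ← cOp_eq_symC]

theorem linearIndependent_cOp (n : ℕ) :
    LinearIndependent ℂ (fun p : Fin (n / 2 + 1) => cOp n (2 * (p : ℕ))) := by
  rw [Fintype.linearIndependent_iff]
  intro g hg q
  have h := congrArg (fun A => (A * cOp n (2 * (q : ℕ))).trace) hg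
  simp only [Finset.sum_mul, trace_sum, smul_mul_assoc, trace_smul, zero_mul, trace_zero] at h
  rw [Finset.sum_eq_single q, smul_eq_mul] at h
  · exact (mul_eq_zero.mp h).resolve_right (trace_cOp_sq_ne_zero (by omega))
  · intro p _ hpq
    rw [cOp_eq_symC, cOp_eq_symC, trace_symC_mul_symC, smul_zero]
    intro h'
    exact hpq (Fin.ext (by omega))
  · simp

/-- One inclusion is the spectral form; equality follows by dimension, since there are as many
independent `C_l` as values of `j`. -/
theorem span_cOp (n : ℕ) :
    Submodule.span ℂ (Set.range fun p : Fin (n / 2 + 1) => cOp n (2 * (p : ℕ))) =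
      Submodule.span ℂ (proj n '' (twiceSpins n : Set ℕ)) := by
  classical
  refine Submodule.eq_of_le_of_finrank_le ?_ ?_
  · rw [Submodule.span_le]
    rintro _ ⟨p, rfl⟩
    simp only [SetLike.mem_coe]
    rw [cOp_eq_sum]
    exact Submodule.sum_mem _ fun t ht => Submodule.smul_mem _ _
      (Submodule.subset_span ⟨t, ht, rfl⟩)
  · rw [finrank_span_eq_card (linearIndependent_cOp n), Fintype.card_fin, ← card_twiceSpins,
      ← Finset.coe_image]
    exact (finrank_span_finset_le_card _).trans Finset.card_image_le

/-! ### Orthogonality to local operators -/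

theorem letter_rev (a : Fin 4) (ha : a ≠ 0) (i : Fin 2) :
    letter a i.rev i.rev = -letter a i i := by
  fin_cases a
  · exact absurd rfl ha
  all_goals fin_cases i <;> simp [letter, pauli]

theorem card_support {n : ℕ} (w : Fin n → Fin 4) :
    #{i | w i ≠ 0} = cnt w 1 + cnt w 2 + cnt w 3 := by
  have h1 := cnt_sum w
  have h2 := Finset.card_filter_add_card_filter_not (s := (univ : Finset (Fin n)))
    (fun i => w i = 0)
  rw [Finset.card_fin] at h2
  simp only [cnt, ne_eq] at *
  omega

/-- Some qubit `r` outside `S` carries a non-identity letter. Only entries diagonal at `r` matter.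
Flipping bit `r` in both indices preserves those of `A` and negates those of the string, so the
trace equals its own negative. -/
theorem trace_local_mul_pauliString {n k : ℕ} {A : Op n} (hA : IsLocal k A) {w : Fin n → Fin 4}
    (hw : k < cnt w 1 + cnt w 2 + cnt w 3) : (Aᴴ * pauliString w).trace = 0 := by
  obtain ⟨S, hS, B, hB⟩ := hA
  obtain ⟨r, hr, hrS⟩ : ∃ r, w r ≠ 0 ∧ r ∉ S := by
    rw [← card_support] at hw
    obtain ⟨r, hr, hrS⟩ := Finset.exists_mem_notMem_of_card_lt_card (hS.trans_lt hw)
    exact ⟨r, (Finset.mem_filter.mp hr).2, hrS⟩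
  have inv : Function.Involutive fun x : Fin n → Fin 2 => Function.update x r (x r).rev := by
    intro x
    simp
  let e := inv.toPerm
  have he : ∀ x, e x = Function.update x r (x r).rev := fun x => rfl
  have key : ∀ x y, star (A (e y) (e x)) * pauliString w (e y) (e x) =
      -(star (A y x) * pauliString w y x) := by
    intro x y
    by_cases hxy : y r = x r
    · have h1 : A (e y) (e x) = A y x := by
        have hres : ∀ z : Fin n → Fin 2, (fun s : S => e z s) = fun s : S => z s := by
          intro z
          funext s
          rw [he, Function.update_of_ne]
          rintro h
          exact hrS (h ▸ s.2)
        rw [hB, hB, hres, hres]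
        congr 1
        refine propext (forall₂_congr fun s _ => ?_)
        rw [he, he]
        by_cases hs : s = r
        · subst hs; simp [hxy]
        · rw [Function.update_of_ne hs, Function.update_of_ne hs]
      have h2 : pauliString w (e y) (e x) = -pauliString w y x := by
        simp only [pauliString, tens, Matrix.of_apply]
        rw [← Finset.mul_prod_erase _ _ (Finset.mem_univ r),
          ← Finset.mul_prod_erase _ (fun i => letter (w i) (y i) (x i)) (Finset.mem_univ r),
          he, he, Function.update_self, Function.update_self, hxy, letter_rev _ hr, neg_mul]
        congr 2
        refine Finset.prod_congr rfl fun i hi => ?_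
        rw [Function.update_of_ne (Finset.ne_of_mem_erase hi),
          Function.update_of_ne (Finset.ne_of_mem_erase hi)]
      rw [h1, h2, mul_neg]
    · have h1 : A y x = 0 := by
        rw [hB, if_neg fun h => hxy (h r hrS)]
      have h2 : A (e y) (e x) = 0 := by
        rw [hB, if_neg]
        intro h
        have := h r hrS
        rw [he, he, Function.update_self, Function.update_self, Fin.rev_inj] at this
        exact hxy this
      rw [h1, h2]
      simp
  have h : (Aᴴ * pauliString w).trace = ∑ x, ∑ y, star (A y x) * pauliString w y x := by
    simp only [Matrix.trace, Matrix.diag, Matrix.mul_apply, Matrix.conjTranspose_apply]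
  have h' : ∑ x, ∑ y, star (A y x) * pauliString w y x =
      -∑ x, ∑ y, star (A y x) * pauliString w y x := by
    conv_lhs => rw [← Equiv.sum_comp e]
    rw [← Finset.sum_neg_distrib]
    refine Finset.sum_congr rfl fun x _ => ?_
    rw [← Equiv.sum_comp e, ← Finset.sum_neg_distrib]
    exact Finset.sum_congr rfl fun y _ => key x y
  rw [h]
  exact self_eq_neg.mp h'

theorem trace_local_mul_symC {n k l : ℕ} (hkl : k < l) {A : Op n} (hA : IsLocal k A) :
    (Aᴴ * symC n l).trace = 0 := by
  rw [symC, symOp, Finset.mul_sum, trace_sum]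
  refine Finset.sum_eq_zero fun w _ => ?_
  rw [Matrix.mul_smul, trace_smul]
  by_cases h : cnt w 1 + cnt w 2 + cnt w 3 = l
  · rw [trace_local_mul_pauliString hA (by omega), smul_zero]
  · rw [coef, if_neg h, zero_smul]

theorem trace_cOp_mul_cOp (n p q : ℕ) :
    (cOp n (2 * p) * cOp n (2 * q)).trace =
      ∑ t ∈ twiceSpins n, (proj n t).trace * cEig n (2 * p) t * cEig n (2 * q) t := by
  conv_lhs => rw [cOp_eq_sum n q]
  rw [Finset.mul_sum, trace_sum]
  refine Finset.sum_congr rfl fun t ht => ?_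
  rw [Matrix.mul_smul, cOp_mul_proj ht, trace_smul, trace_smul, smul_eq_mul, smul_eq_mul]
  ring

end Qubits

theorem mainTheorem8 (n : ℕ) :
    -- the eigenvalue `c_l(j)`: spectral form of `C_l`, explicit formula, integrality
    (∀ l : ℕ, Even l → l ≤ n →
      (Qubits.cOp n l).IsHermitian ∧
      Qubits.cOp n l = ∑ t ∈ Qubits.twiceSpins n, Qubits.cEig n l t • Qubits.proj n t ∧
      ∀ t ∈ Qubits.twiceSpins n,
        Qubits.cOp n l * Qubits.proj n t = Qubits.cEig n l t • Qubits.proj n t ∧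
        Qubits.cEig n l t =
          (((l.factorial : ℝ) / (2 ^ (l / 2) * ((l / 2).factorial : ℝ)) * (n.choose l : ℝ) *
            ∑ r ∈ Finset.range (l / 2 + 1),
              (-4 : ℝ) ^ r * ((l / 2).choose r : ℝ) *
                (Qubits.mult (n - 2 * r) t / Qubits.mult n t) : ℝ) : ℂ) ∧
        ∃ z : ℤ, Qubits.cEig n l t = (z : ℂ)) ∧
    -- `m(n, j)` is the multiplicity of the spin-`j` irrep
    (∀ t ∈ Qubits.twiceSpins n,
      (Qubits.proj n t).trace = ((((t : ℝ) + 1) * Qubits.mult n t : ℝ) : ℂ) ∧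
      Qubits.proj n t ≠ 0) ∧
    -- orthogonality
    (∀ l l' : ℕ, Even l → Even l' → l ≤ n → l' ≤ n →
      (Qubits.cOp n l * Qubits.cOp n l').trace =
        ∑ t ∈ Qubits.twiceSpins n,
          (Qubits.proj n t).trace * Qubits.cEig n l t * Qubits.cEig n l' t ∧
      (Qubits.cOp n l * Qubits.cOp n l').trace =
        if l = l' then (Qubits.cOp n l ^ 2).trace else 0) ∧
    -- the `C_l` form a basis of the span of the projectors
    LinearIndependent ℂ (fun p : Fin (n / 2 + 1) => Qubits.cOp n (2 * (p : ℕ))) ∧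
    Submodule.span ℂ (Set.range fun p : Fin (n / 2 + 1) => Qubits.cOp n (2 * (p : ℕ))) =
      Submodule.span ℂ (Qubits.proj n '' (Qubits.twiceSpins n : Set ℕ)) ∧
    -- orthogonality to `k`-local operators, `k < l`
    (∀ l k : ℕ, Even l → l ≤ n → k < l → ∀ A : Qubits.Op n, Qubits.IsLocal k A →
      (A.conjTranspose * Qubits.cOp n l).trace = 0) ∧
    -- polynomial of degree `l / 2` in `j (j + 1)`, equivalently in `J²`
    (∀ l : ℕ, Even l → l ≤ n → ∃ P : Polynomial ℝ, P.natDegree = l / 2 ∧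
      (∀ t ∈ Qubits.twiceSpins n,
        Qubits.cEig n l t = ((P.eval ((t : ℝ) / 2 * ((t : ℝ) / 2 + 1)) : ℝ) : ℂ)) ∧
      Qubits.cOp n l = Polynomial.aeval (Qubits.angMomSq n) P) ∧
    -- three-term recursion
    (∀ l : ℕ, Even l → 2 ≤ l → l ≤ n →
      Qubits.cOp n 2 * Qubits.cOp n l =
        ((l : ℂ) / 2 + 1) • Qubits.cOp n (l + 2) +
        (((n : ℂ) - (l : ℂ) - 1) * (l : ℂ)) • Qubits.cOp n l +
        (((l : ℂ) + 1) * ((n - l + 2).choose 2 : ℂ)) • Qubits.cOp n (l - 2)) := by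
  refine ⟨?_, fun t ht => ⟨Qubits.trace_proj ht, fun h => Qubits.trace_proj_ne_zero ht ?_⟩, ?_,
    Qubits.linearIndependent_cOp n, Qubits.span_cOp n, ?_, ?_, ?_⟩
  · intro l hl hln
    obtain ⟨p, rfl⟩ := even_iff_two_dvd.mp hl
    refine ⟨?_, Qubits.cOp_eq_sum n p, fun t ht => ⟨Qubits.cOp_mul_proj ht p, ?_, ?_⟩⟩
    · rw [Qubits.cOp_eq_symC]
      exact Qubits.symC_isHermitian n _
    · rw [Qubits.cEig_eq ht, Qubits.eval_polyC_casimir ht hln, Nat.mul_div_cancel_left p two_pos]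
    · obtain ⟨z, hz⟩ := Qubits.eval_polyC_casimir_int ht hln
      exact ⟨z, by rw [Qubits.cEig_eq ht, hz, Complex.ofReal_intCast]⟩
  · rw [h, Matrix.trace_zero]
  · intro l l' hl hl' _ _
    obtain ⟨p, rfl⟩ := even_iff_two_dvd.mp hl
    obtain ⟨q, rfl⟩ := even_iff_two_dvd.mp hl'
    refine ⟨Qubits.trace_cOp_mul_cOp n p q, ?_⟩
    split_ifs with h
    · rw [← h, pow_two]
    · rw [Qubits.cOp_eq_symC, Qubits.cOp_eq_symC, Qubits.trace_symC_mul_symC n h]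
  · intro l k hl _ hkl A hA
    obtain ⟨p, rfl⟩ := even_iff_two_dvd.mp hl
    rw [Qubits.cOp_eq_symC]
    exact Qubits.trace_local_mul_symC hkl hA
  · intro l hl _
    obtain ⟨p, rfl⟩ := even_iff_two_dvd.mp hl
    refine ⟨Qubits.polyC n p, ?_, fun t ht => Qubits.cEig_eq ht p, Qubits.cOp_eq_aeval n p⟩
    rw [Qubits.polyC_natDegree, Nat.mul_div_cancel_left p two_pos]
  · intro l hl hl2 hln
    obtain ⟨q, rfl⟩ := even_iff_two_dvd.mp hl
    -- Writing `l = 2p + 2` matches the shifted index of `symC_two_mul_symC` and avoids truncation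
    -- in `l - 2`.
    obtain ⟨p, rfl⟩ : ∃ p, q = p + 1 := ⟨q - 1, by omega⟩
    have h := Qubits.symC_two_mul_symC n (2 * p)
    rw [show 2 * p + 4 = 2 * (p + 2) by ring, show 2 * p + 2 = 2 * (p + 1) by ring,
      ← Qubits.cOp_eq_symC n (p + 2), ← Qubits.cOp_eq_symC n (p + 1), ← Qubits.cOp_eq_symC n p,
      show Qubits.symC n 2 = Qubits.cOp n 2 from (Qubits.cOp_eq_symC n 1).symm] at h
    rw [show 2 * (p + 1) + 2 = 2 * (p + 2) by ring, show 2 * (p + 1) - 2 = 2 * p by omega, h,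
      Nat.cast_choose_two, show n - 2 * (p + 1) + 2 = n - 2 * p by omega,
      Nat.cast_sub (show 2 * p ≤ n by omega)]
    push_cast
    match_scalars <;> ring
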